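/- Let $G_n:\mathbb{R}\to[0,\infty)$ ($n\ge 0$) be bounded measurable functions, let $\eta_0^f,\eta_0^c$ be probability measures on $\mathbb{R}$ and let $M_n^f,M_n^c$ ($n\ge 1$) be Markov kernels on $\mathbb{R}$. Let $\check\eta_0$ be a coupling of $(\eta_0^f,\eta_0^c)$ and, for $n\ge 1$, let $\check M_n$ be a Markov kernel on $\mathbb{R}^2$ such that $\check M_n((x,x'),\cdot)$ is a coupling of $(M_n^f(x,\cdot),M_n^c(x',\cdot))$ for all $x,x'$. For $s\in\{f,c\}$ put $$\gamma_n^s(\varphi)=\int\varphi(x_n)\prod_{p=0}^{n-1}G_p(x_p)\,\eta_0^s(dx_0)\prod_{p=1}^nM_p^s(x_{p-1},dx_p),\qquad \eta_n^s(\varphi)=\frac{\gamma_n^s(\varphi)}{\gamma_n^s(1)},\qquad \overline\eta_n^s(\varphi)=\frac{\eta_n^s(G_n\varphi)}{\eta_n^s(G_n)},$$ and assume that $\eta_n^s(G_n)>0$ and that the distribution function of $\overline\eta_n^s$ is continuous on $\mathbb{R}$ and its generalized inverse is continuous on $(0,1)$, for all $n\ge 0$ and $s\in\{f,c\}$. For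 a probability measure $\mu$ on $\mathbb{R}$ write $F_\mu^{-1}(w)=\inf\{x:\mu((-\infty,x])\ge w\}$ and, for $n\ge1$, define the probability measure $\check\Phi_n^W(\mu,\nu)$ on $\mathbb{R}^2$ by $$\check\Phi_n^W(\mu,\nu)(\varphi)=\int_0^1\check M_n(\varphi)\big(F_\mu^{-1}(w),F_\nu^{-1}(w)\big)\,dw .$$ Put $\check\eta_0^W=\check\eta_0$ and $\check\eta_n^W=\check\Phi_n^W(\overline\eta_{n-1}^f,\overline\eta_{n-1}^c)$ for $n\ge 1$. For $N\ge1$ let $u_p^i=(x_p^{i,f},x_p^{i,c})$, $1\le i\le N$, $p\ge 0$, be the following particle system: $u_0^1,\dots,u_0^N$ are i.i.d. with law $\check\eta_0$, and for $p\ge1$, given $u_0^{1:N},\dots,u_{p-1}^{1:N}$, the pairs $u_p^1,\dots,u_p^N$ are i.i.d. with law $\check\Phi_p^W(\overline\eta_{p-1}^{N,f},\overline\eta_{p-1}^{N,c})$, where $$\overline\eta_{p-1}^{N,s}=\sum_{i=1}^N\frac{G_{p-1}(x_{p-1}^{i,s})}{\sum_{j=1}^NG_{p-1}(x_{p-1}^{j,s})}\,\delta_{x_{p-1}^{i,s}}$$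 (with a fixed convention on the event that all these weights vanish). Put $\check\eta_n^{N,W}=\frac1N\sum_{i=1}^N\delta_{u_n^i}$. Finally, for $0\le p\le n$ let $Q_{p,n}^s$ be the composition of the kernels $G_q(x)M_{q+1}^s(x,dy)$, $q=p,\dots,n-1$ (the identity if $p=n$), and $$D_{p,n}^s(\varphi)=\frac{Q_{p,n}^s(\varphi-\eta_n^s(\varphi))}{\eta_p^s(Q_{p,n}^s(1))}.$$ Suppose that $\check M_n$, $M_n^f$, $M_n^c$ are Feller (they map bounded continuous functions to continuous functions) for every $n\ge1$ and that $G_n$ is continuous for every $n\ge0$. Then for all $n\ge0$, $q\ge1$ and bounded continuous $\varphi_1,\dots,\varphi_q,\psi_1,\dots,\psi_q:\mathbb{R}\to\mathbb{R}$, as $N\to\infty$, $$\sqrt N\Big([\check\eta_n^{N,W}-\check\eta_n^W](\varphi_1\otimes1-1\otimes\psi_1),\dots,[\check\eta_n^{N,W}-\check\eta_n^W](\varphi_q\otimes1-1\otimes\psi_q)\Big)\Rightarrow\mathcal N_q(0,\Sigma),$$ where $\Sigma$ is the positive semidefinite matrix with entries $$\Sigma_{ij}=\sum_{p=0}^n\check\eta_p^W\Big([D_{p,n}^f(\varphi_i)\otimes1-1\otimes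 D_{p,n}^c(\psi_i)]\,[D_{p,n}^f(\varphi_j)\otimes1-1\otimes D_{p,n}^c(\psi_j)]\Big),\qquad 1\le i,j\le q.$$ Here $(\varphi\otimes1-1\otimes\psi)(x,y)=\varphi(x)-\psi(y)$ and $\mu(\varphi)=\int\varphi\,d\mu$. -/

import Mathlib

open MeasureTheory ProbabilityTheory Filter Topology
open scoped ENNReal BoundedContinuousFunction

namespace MLPF

noncomputable section

/-! ### Generalized inverses of distribution functions and the Wasserstein coupling -/

/-- The generalized inverse `F_μ⁻¹(w) = inf {x : F_μ(x) ≥ w}` of the distribution function of `μ`.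
Only its values for `w ∈ (0,1)` are ever used. -/
def quantile (μ : Measure ℝ) (w : ℝ) : ℝ := sInf {x : ℝ | w ≤ cdf μ x}

/-- The measure `∫₀¹ δ_{(F_μ⁻¹(w), F_ν⁻¹(w))} dw` on `ℝ × ℝ`. -/
def wassersteinCoupling (μ ν : Measure ℝ) : Measure (ℝ × ℝ) :=
  (volume.restrict (Set.Ioo (0 : ℝ) 1)).map fun w => (quantile μ w, quantile ν w)

/-- The Feller property: the kernel maps bounded continuous functions to (bounded) continuous
functions. -/
def IsFeller {E : Type*} [TopologicalSpace E] [MeasurableSpace E] (κ : Kernel E E) : Prop :=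
  ∀ φ : E →ᵇ ℝ, Continuous fun x => ∫ y, φ y ∂κ x

/-! ### The model -/

/-- The two levels: fine (`f`) and coarse (`c`). -/
inductive Level
  | f
  | c

/-- The pair of Feynman-Kac models on `ℝ`, with a coupling of the two initial laws and a coupling
of the two Markov kernels at each time. The kernels `M s n` and `Mc n` play a role only for
`n ≥ 1`; they move the state from time `n - 1` to time `n`. -/
structure CoupledModel where
  /-- the potentials `G_n` -/
  G : ℕ → ℝ → ℝ
  G_measurable : ∀ n, Measurable (G n)
  G_nonneg : ∀ n x, 0 ≤ G n x
  G_bounded : ∀ n, ∃ C : ℝ, ∀ x, G n x ≤ C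
  /-- the initial laws `η_0^s` -/
  init : Level → Measure ℝ
  init_prob : ∀ s, IsProbabilityMeasure (init s)
  /-- the Markov kernels `M_n^s` -/
  M : Level → ℕ → Kernel ℝ ℝ
  M_markov : ∀ s n, IsMarkovKernel (M s n)
  /-- the given coupling of `η_0^f` and `η_0^c` -/
  initc : Measure (ℝ × ℝ)
  initc_prob : IsProbabilityMeasure initc
  initc_fst : ∀ A : Set ℝ, MeasurableSet A → initc (A ×ˢ Set.univ) = init Level.f A
  initc_snd : ∀ A : Set ℝ, MeasurableSet A → initc (Set.univ ×ˢ A) = init Level.c A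
  /-- the given couplings of `M_n^f` and `M_n^c` -/
  Mc : ℕ → Kernel (ℝ × ℝ) (ℝ × ℝ)
  Mc_markov : ∀ n, IsMarkovKernel (Mc n)
  Mc_fst : ∀ n, 1 ≤ n → ∀ (u : ℝ × ℝ) (A : Set ℝ), MeasurableSet A →
    Mc n u (A ×ˢ Set.univ) = M Level.f n u.1 A
  Mc_snd : ∀ n, 1 ≤ n → ∀ (u : ℝ × ℝ) (A : Set ℝ), MeasurableSet A →
    Mc n u (Set.univ ×ˢ A) = M Level.c n u.2 A

namespace CoupledModel

variable (m : CoupledModel)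

/-- The unnormalized measure `γ_n^s`:
`γ_n^s(φ) = ∫ φ(x_n) (∏_{p<n} G_p(x_p)) η_0^s(dx_0) ∏_{1≤p≤n} M_p^s(x_{p-1}, dx_p)`,
the iterated integral being carried out one time step after the other. -/
def gam (s : Level) : ℕ → Measure ℝ
  | 0 => m.init s
  | n + 1 => ((gam s n).withDensity fun x => ENNReal.ofReal (m.G n x)).bind (m.M s (n + 1))

/-- The predictor `η_n^s = γ_n^s / γ_n^s(1)`. -/
def eta (s : Level) (n : ℕ) : Measure ℝ := (m.gam s n Set.univ)⁻¹ • m.gam s n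

/-- The filter `φ ↦ η_n^s(G_n φ) / η_n^s(G_n)`. -/
def etaBar (s : Level) (n : ℕ) : Measure ℝ :=
  (∫⁻ x, ENNReal.ofReal (m.G n x) ∂m.eta s n)⁻¹ •
    (m.eta s n).withDensity fun x => ENNReal.ofReal (m.G n x)

/-- The measure `φ ↦ ∫₀¹ Mc_n(φ)(F_μ⁻¹(w), F_ν⁻¹(w)) dw`. -/
def PhiW (n : ℕ) (μ ν : Measure ℝ) : Measure (ℝ × ℝ) :=
  (wassersteinCoupling μ ν).bind (m.Mc n)

/-- The limiting coupling of `η_n^f` and `η_n^c`. -/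
def etaW : ℕ → Measure (ℝ × ℝ)
  | 0 => m.initc
  | n + 1 => m.PhiW (n + 1) (m.etaBar Level.f n) (m.etaBar Level.c n)

/-- `Qsg s p k = Q_{p,p+k}^s`, where `Q_{p,n}^s` is the composition of the kernels
`G_q(x) M_{q+1}^s(x, dy)`, `p ≤ q < n`. -/
def Qsg (s : Level) : ℕ → ℕ → (ℝ → ℝ) → ℝ → ℝ
  | _, 0, φ => φ
  | p, k + 1, φ => fun x => m.G p x * ∫ y, Qsg s (p + 1) k φ y ∂m.M s (p + 1) x

/-- `Q_{p,n}^s` (used for `p ≤ n`). -/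
def Q (s : Level) (p n : ℕ) (φ : ℝ → ℝ) : ℝ → ℝ := m.Qsg s p (n - p) φ

/-- `D_{p,n}^s(φ) = Q_{p,n}^s(φ - η_n^s(φ)) / η_p^s(Q_{p,n}^s(1))` (used for `p ≤ n`; for `p = n`
this is `φ - η_n^s(φ)`). -/
def D (s : Level) (p n : ℕ) (φ : ℝ → ℝ) (x : ℝ) : ℝ :=
  m.Q s p n (fun y => φ y - ∫ z, φ z ∂m.eta s n) x / ∫ z, m.Q s p n (fun _ => 1) z ∂m.eta s p

/-- The asymptotic covariance matrix. -/
def asympCov (n : ℕ) {q : ℕ} (φ ψ : Fin q → ℝ → ℝ) : Matrix (Fin q) (Fin q) ℝ :=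
  Matrix.of fun i j => ∑ p ∈ Finset.range (n + 1),
    ∫ u, (m.D Level.f p n (φ i) u.1 - m.D Level.c p n (ψ i) u.2) *
      (m.D Level.f p n (φ j) u.1 - m.D Level.c p n (ψ j) u.2) ∂m.etaW p

end CoupledModel

/-! ### Measurability of the resampling step -/

theorem quantile_le_iff (μ : Measure ℝ) {w : ℝ} (hw : w ∈ Set.Ioo (0 : ℝ) 1) (t : ℝ) :
    quantile μ w ≤ t ↔ w ≤ cdf μ t := by
  have hne : {x : ℝ | w ≤ cdf μ x}.Nonempty := by
    obtain ⟨x, hx⟩ := ((tendsto_cdf_atTop μ).eventually (eventually_ge_nhds hw.2)).exists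
    exact ⟨x, hx⟩
  have hbdd : BddBelow {x : ℝ | w ≤ cdf μ x} := by
    obtain ⟨x, hx⟩ := ((tendsto_cdf_atBot μ).eventually (eventually_lt_nhds hw.1)).exists
    refine ⟨x, fun y hy => ?_⟩
    by_contra h
    exact absurd (le_trans hy (monotone_cdf μ (not_le.1 h).le)) (not_le.2 hx)
  constructor
  · intro h
    have key : ∀ y, t < y → w ≤ cdf μ y := by
      intro y hy
      obtain ⟨z, hz, hzy⟩ := exists_lt_of_csInf_lt hne (lt_of_le_of_lt h hy)
      exact le_trans hz (monotone_cdf μ hzy.le)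
    have hc : Tendsto (cdf μ) (𝓝[>] t) (𝓝 (cdf μ t)) :=
      ((cdf μ).right_continuous t).mono_left (nhdsWithin_mono _ Set.Ioi_subset_Ici_self)
    exact ge_of_tendsto hc (eventually_nhdsWithin_of_forall fun y hy => key y hy)
  · intro h
    exact csInf_le hbdd h

open Classical in
theorem measurable_quantile_joint {α : Type*} [MeasurableSpace α] (μ : α → Measure ℝ)
    (hμ : ∀ t, Measurable fun a => cdf (μ a) t) :
    Measurable fun z : α × ℝ => if z.2 ∈ Set.Ioo (0 : ℝ) 1 then quantile (μ z.1) z.2 else 0 := by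
  refine measurable_of_Iic fun t => ?_
  have hI : MeasurableSet {z : α × ℝ | z.2 ∈ Set.Ioo (0 : ℝ) 1} := measurable_snd measurableSet_Ioo
  have hS : MeasurableSet {z : α × ℝ | z.2 ≤ cdf (μ z.1) t} :=
    measurableSet_le measurable_snd ((hμ t).comp measurable_fst)
  have hC : MeasurableSet {_z : α × ℝ | (0 : ℝ) ≤ t} := MeasurableSet.const _
  have : (fun z : α × ℝ => if z.2 ∈ Set.Ioo (0 : ℝ) 1 then quantile (μ z.1) z.2 else 0) ⁻¹'
      Set.Iic t = ({z | z.2 ∈ Set.Ioo (0 : ℝ) 1} ∩ {z | z.2 ≤ cdf (μ z.1) t}) ∪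
        ({z | z.2 ∈ Set.Ioo (0 : ℝ) 1}ᶜ ∩ {_z | (0 : ℝ) ≤ t}) := by
    ext z
    by_cases hz : z.2 ∈ Set.Ioo (0 : ℝ) 1
    · have := quantile_le_iff (μ z.1) hz t
      simp only [Set.mem_preimage, Set.mem_Iic, if_pos hz, this]
      simp only [Set.mem_union, Set.mem_inter_iff, Set.mem_ofPred_eq, Set.mem_compl_iff, hz]
      simp
    · simp only [Set.mem_preimage, Set.mem_Iic, if_neg hz]
      simp only [Set.mem_union, Set.mem_inter_iff, Set.mem_ofPred_eq, Set.mem_compl_iff, hz]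
      simp
  rw [this]
  exact (hI.inter hS).union (hI.compl.inter hC)

open Classical in
theorem wassersteinCoupling_eq (μ ν : Measure ℝ) : wassersteinCoupling μ ν =
    (volume.restrict (Set.Ioo (0 : ℝ) 1)).map fun w =>
      (if w ∈ Set.Ioo (0 : ℝ) 1 then quantile μ w else 0,
        if w ∈ Set.Ioo (0 : ℝ) 1 then quantile ν w else 0) := by
  refine Measure.map_congr ?_
  filter_upwards [ae_restrict_mem measurableSet_Ioo] with w hw
  simp only [if_pos hw]

theorem measurable_wassersteinCoupling {α : Type*} [MeasurableSpace α] (μ ν : α → Measure ℝ)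
    (hμ : ∀ t, Measurable fun a => cdf (μ a) t) (hν : ∀ t, Measurable fun a => cdf (ν a) t) :
    Measurable fun a => wassersteinCoupling (μ a) (ν a) := by
  classical
  have hj := (measurable_quantile_joint μ hμ).prodMk (measurable_quantile_joint ν hν)
  refine Measure.measurable_of_measurable_coe _ fun A hA => ?_
  have := measurable_measure_prodMk_left (ν := volume.restrict (Set.Ioo (0 : ℝ) 1)) (hj hA)
  convert this using 1
  funext a
  rw [wassersteinCoupling_eq]
  exact Measure.map_apply (hj.comp (measurable_prodMk_left (x := a))) hA

instance isProbabilityMeasure_wassersteinCoupling (μ ν : Measure ℝ) :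
    IsProbabilityMeasure (wassersteinCoupling μ ν) := by
  classical
  have hj := (measurable_quantile_joint (fun _ : Unit => μ) fun t => measurable_const).prodMk
    (measurable_quantile_joint (fun _ : Unit => ν) fun t => measurable_const)
  have : IsProbabilityMeasure (volume.restrict (Set.Ioo (0 : ℝ) 1)) := ⟨by simp⟩
  rw [wassersteinCoupling_eq]
  exact Measure.isProbabilityMeasure_map
    (hj.comp (measurable_prodMk_left (x := ()))).aemeasurable

namespace CoupledModel

variable (m : CoupledModel)

instance (s : Level) (n : ℕ) : IsMarkovKernel (m.M s n) := m.M_markov s n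

instance (n : ℕ) : IsMarkovKernel (m.Mc n) := m.Mc_markov n

instance : IsProbabilityMeasure m.initc := m.initc_prob

instance (s : Level) : IsProbabilityMeasure (m.init s) := m.init_prob s

instance (n : ℕ) (μ ν : Measure ℝ) : IsProbabilityMeasure (m.PhiW n μ ν) := by
  unfold PhiW
  infer_instance

/-! ### The particle algorithm -/

/-- The weighted empirical measure `∑_i G_n(x^i) / (∑_j G_n(x^j)) δ_{x^i}`. If all the weights
vanish, this formula gives the zero measure; the algorithm then continues with whatever
quantities `cdf` attaches to the zero measure, an event of asymptotically vanishing
probability. -/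
def etaBarN (n : ℕ) {N : ℕ} (x : Fin N → ℝ) : Measure ℝ :=
  ∑ i, ENNReal.ofReal (m.G n (x i) / ∑ j, m.G n (x j)) • Measure.dirac (x i)

theorem measurable_cdf_etaBarN (n N : ℕ) (t : ℝ) :
    Measurable fun x : Fin N → ℝ => cdf (m.etaBarN n x) t := by
  classical
  have hG : ∀ i, Measurable fun x : Fin N → ℝ => m.G n (x i) := fun i =>
    (m.G_measurable n).comp (measurable_pi_apply i)
  have hS : Measurable fun x : Fin N → ℝ => ∑ j, m.G n (x j) :=
    Finset.measurable_fun_sum _ fun j _ => hG j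
  have hset : MeasurableSet {x : Fin N → ℝ | ∑ j, m.G n (x j) = 0} :=
    hS (measurableSet_singleton 0)
  have hmeas : Measurable fun x : Fin N → ℝ => (m.etaBarN n x).real (Set.Iic t) := by
    have : ∀ x : Fin N → ℝ, (m.etaBarN n x).real (Set.Iic t) =
        (∑ i, ENNReal.ofReal (m.G n (x i) / ∑ j, m.G n (x j)) *
          (Set.Iic t).indicator (1 : ℝ → ℝ≥0∞) (x i)).toReal := by
      intro x
      simp [etaBarN, Measure.real, Measure.finsetSum_apply, Measure.dirac_apply' _ measurableSet_Iic]
    simp_rw [this]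
    refine ENNReal.measurable_toReal.comp (Finset.measurable_fun_sum _ fun i _ => ?_)
    exact (((hG i).div hS).ennreal_ofReal).mul
      ((measurable_one.indicator measurableSet_Iic).comp (measurable_pi_apply i))
  have heq : (fun x : Fin N → ℝ => cdf (m.etaBarN n x) t) = fun x =>
      if ∑ j, m.G n (x j) = 0 then cdf (0 : Measure ℝ) t else (m.etaBarN n x).real (Set.Iic t) := by
    funext x
    split_ifs with h
    · have : m.etaBarN n x = 0 := by simp [etaBarN, h]
      rw [this]
    · have hp : 0 ≤ ∑ j, m.G n (x j) := Finset.sum_nonneg fun j _ => m.G_nonneg n _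
      have : IsProbabilityMeasure (m.etaBarN n x) := by
        refine ⟨?_⟩
        simp only [etaBarN, Measure.finsetSum_apply, Measure.smul_apply, measure_univ, smul_eq_mul,
          mul_one]
        rw [← ENNReal.ofReal_sum_of_nonneg fun i _ => div_nonneg (m.G_nonneg n _) hp,
          ← Finset.sum_div, div_self h, ENNReal.ofReal_one]
      rw [cdf_eq_real]
  rw [heq]
  exact Measurable.ite hset measurable_const hmeas

/-- The law of one particle at time `n + 1` given the particles `u` at time `n`. -/
def particleLaw (n : ℕ) {N : ℕ} (u : Fin N → ℝ × ℝ) : Measure (ℝ × ℝ) :=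
  m.PhiW (n + 1) (m.etaBarN n fun i => (u i).1) (m.etaBarN n fun i => (u i).2)

instance (n : ℕ) {N : ℕ} (u : Fin N → ℝ × ℝ) : IsProbabilityMeasure (m.particleLaw n u) := by
  unfold particleLaw
  infer_instance

theorem measurable_particleLaw (n N : ℕ) :
    Measurable fun u : Fin N → ℝ × ℝ => m.particleLaw n u := by
  refine (Measure.measurable_bind' (m.Mc (n + 1)).measurable).comp
    (measurable_wassersteinCoupling _ _ (fun t => ?_) fun t => ?_)
  · exact (m.measurable_cdf_etaBarN n N t).comp
      (measurable_pi_lambda _ fun i => (measurable_pi_apply i).fst)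
  · exact (m.measurable_cdf_etaBarN n N t).comp
      (measurable_pi_lambda _ fun i => (measurable_pi_apply i).snd)

theorem measurable_pi_particleLaw (n N : ℕ) :
    Measurable fun u : Fin N → ℝ × ℝ => Measure.pi fun _ : Fin N => m.particleLaw n u := by
  refine Measurable.measure_of_isPiSystem_of_isProbabilityMeasure generateFrom_pi.symm
    isPiSystem_pi ?_
  rintro _ ⟨A, hA, rfl⟩
  simp only [Measure.pi_pi]
  refine Finset.measurable_fun_prod _ fun i _ => ?_
  exact (Measure.measurable_coe (show MeasurableSet (A i) from hA i (Set.mem_univ i))).comp (m.measurable_particleLaw n N)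

/-- The transition of the particle system from time `n` to time `n + 1`: given the `N` pairs at
time `n`, the `N` pairs at time `n + 1` are independent with law `particleLaw`. -/
def particleKernel (N n : ℕ) : Kernel (Fin N → ℝ × ℝ) (Fin N → ℝ × ℝ) where
  toFun u := Measure.pi fun _ => m.particleLaw n u
  measurable' := m.measurable_pi_particleLaw n N

instance (N n : ℕ) : IsMarkovKernel (m.particleKernel N n) :=
  ⟨fun u => by
    change IsProbabilityMeasure (Measure.pi fun _ : Fin N => m.particleLaw n u)
    infer_instance⟩

/-- The law, on `(ℕ → Fin N → ℝ × ℝ)`, of the particle system `(u_n^{1:N})_{n ≥ 0}`: at time `0`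
the pairs are i.i.d. from the coupling of the initial laws, and given the past up to time `n` the
pairs at time `n + 1` are drawn from `particleKernel N n` started at the pairs at time `n`. -/
def systemLaw (N : ℕ) : Measure (ℕ → Fin N → ℝ × ℝ) :=
  Kernel.trajMeasure (X := fun _ => Fin N → ℝ × ℝ) (Measure.pi fun _ => m.initc)
    fun n => (m.particleKernel N n).comap
      (fun h : (i : Finset.Iic n) → Fin N → ℝ × ℝ => h ⟨n, Finset.mem_Iic.2 le_rfl⟩)
      (measurable_pi_apply _)

instance (N : ℕ) : IsProbabilityMeasure (m.systemLaw N) := by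
  unfold systemLaw
  infer_instance

/-- The empirical measure `N⁻¹ ∑_i δ_{u^i}`. -/
def empirical {N : ℕ} (u : Fin N → ℝ × ℝ) : Measure (ℝ × ℝ) :=
  (N : ℝ≥0∞)⁻¹ • ∑ i, Measure.dirac (u i)

/-- The scaled error `√N [η_n^{N,W} - η_n^W](φ ⊗ 1 - 1 ⊗ ψ)`, as a function of the trajectory `u`
of the particle system. -/
def scaledError (n N : ℕ) (φ ψ : ℝ → ℝ) (u : ℕ → Fin N → ℝ × ℝ) : ℝ :=
  √(N : ℝ) * (∫ z, (φ z.1 - ψ z.2) ∂empirical (u n) - ∫ z, (φ z.1 - ψ z.2) ∂m.etaW n)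

end CoupledModel

end

end MLPF

/-! The errors are linear in the pair `(φ, ψ)`, and the quadratic form of `asympCov` at `t` is
`asympVar` of the combined pair (`sum_asympCov_eq_asympVar`). By Lévy's continuity theorem it
therefore suffices that, for a single bounded continuous pair, the characteristic function of the
scaled error tends to `exp (-asympVar / 2)`; this is `tendsto_charError`, an induction on time.

Given the particles at time `n`, those at time `n + 1` are i.i.d. from the random law `particleLaw`.
Up to `O(1/√N)`, the conditional characteristic function is then a phase, given by the error of the
conditional mean, times a Gaussian factor with the conditional variance
(`norm_integral_exp_mean_sub_le`). Two facts close the step.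

The conditional mean only sees the marginals of `particleLaw`, which do not depend on the coupling.
On each level its error (`drift`) is a ratio of empirical means. Linearizing the ratio leaves a
product of two errors of order `N^(-1/2)` in mean square (`meanSqRate`), hence `O(1/N)` in the mean,
which is negligible after multiplication by `√N`. So the drift becomes the error at time `n` of the
function `pull` (`exists_integral_abs_drift_sub_le`).

The conditional variance does see the coupling. It converges in the mean to the variance under `etaW
(n + 1)`, because the distribution functions of the weighted empirical measures converge pointwise
in mean square, continuity of the limiting quantiles transfers this to the quantiles at each fixed
`w`, and the Feller kernel `Mc` preserves continuous test functions
(`tendsto_integral_abs_particleLaw_sub`).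

The Gaussian factor is thus asymptotically deterministic and leaves the expectation; what remains is
the characteristic function at time `n` for the pulled back pair. Since `D_succ` says that `D`
absorbs `pull`, the variances add up to `asympVar` (`asympVar_succ`). -/

namespace MLPF

/-! ### Calculus of bounded measurable functions. -/

section BoundedMeasurable

variable {E F : Type*} [MeasurableSpace E] [MeasurableSpace F]

/-- Bounded measurable real functions. -/
structure BddMeas (φ : E → ℝ) : Prop where
  measurable : Measurable φ
  bounded : ∃ C, ∀ x, |φ x| ≤ C

theorem BddMeas.exists_nonneg_bound {φ : E → ℝ} (h : BddMeas φ) : ∃ C, 0 ≤ C ∧ ∀ x, |φ x| ≤ C := by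
  obtain ⟨C, hC⟩ := h.bounded
  exact ⟨|C|, abs_nonneg _, fun x => (hC x).trans (le_abs_self _)⟩

theorem BddMeas.const (c : ℝ) : BddMeas fun _ : E => c := ⟨measurable_const, |c|, fun _ => le_rfl⟩

theorem BddMeas.add {φ ψ : E → ℝ} (h : BddMeas φ) (h' : BddMeas ψ) :
    BddMeas fun x => φ x + ψ x := by
  obtain ⟨C, hC⟩ := h.bounded
  obtain ⟨C', hC'⟩ := h'.bounded
  exact ⟨h.measurable.add h'.measurable, C + C', fun x =>
    (abs_add_le _ _).trans (add_le_add (hC x) (hC' x))⟩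

theorem BddMeas.sub {φ ψ : E → ℝ} (h : BddMeas φ) (h' : BddMeas ψ) :
    BddMeas fun x => φ x - ψ x := by
  obtain ⟨C, hC⟩ := h.bounded
  obtain ⟨C', hC'⟩ := h'.bounded
  exact ⟨h.measurable.sub h'.measurable, C + C', fun x =>
    (abs_sub _ _).trans (add_le_add (hC x) (hC' x))⟩

theorem BddMeas.mul {φ ψ : E → ℝ} (h : BddMeas φ) (h' : BddMeas ψ) :
    BddMeas fun x => φ x * ψ x := by
  obtain ⟨C, h0, hC⟩ := h.exists_nonneg_bound
  obtain ⟨C', hC'⟩ := h'.bounded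
  refine ⟨h.measurable.mul h'.measurable, C * C', fun x => ?_⟩
  rw [abs_mul]
  exact mul_le_mul (hC x) (hC' x) (abs_nonneg _) h0

theorem BddMeas.const_mul {φ : E → ℝ} (h : BddMeas φ) (c : ℝ) : BddMeas fun x => c * φ x :=
  (BddMeas.const c).mul h

theorem BddMeas.div_const {φ : E → ℝ} (h : BddMeas φ) (c : ℝ) : BddMeas fun x => φ x / c := by
  simpa only [div_eq_mul_inv] using h.mul (BddMeas.const c⁻¹)

theorem BddMeas.sq {φ : E → ℝ} (h : BddMeas φ) : BddMeas fun x => φ x ^ 2 := by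
  simpa only [pow_two] using h.mul h

theorem BddMeas.abs {φ : E → ℝ} (h : BddMeas φ) : BddMeas fun x => |φ x| := by
  obtain ⟨C, hC⟩ := h.bounded
  exact ⟨h.measurable.abs, C, fun x => by simpa using hC x⟩

theorem BddMeas.comp {φ : F → ℝ} (h : BddMeas φ) {g : E → F} (hg : Measurable g) :
    BddMeas fun x => φ (g x) := by
  obtain ⟨C, hC⟩ := h.bounded
  exact ⟨h.measurable.comp hg, C, fun x => hC _⟩

theorem BddMeas.sum {ι : Type*} (s : Finset ι) {φ : ι → E → ℝ} (h : ∀ i, BddMeas (φ i)) :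
    BddMeas fun x => ∑ i ∈ s, φ i x := by
  classical
  induction s using Finset.induction_on with
  | empty => simpa using BddMeas.const 0
  | insert a s ha ih =>
    simp only [Finset.sum_insert ha]
    exact (h a).add ih

theorem BddMeas.integrable {φ : E → ℝ} (h : BddMeas φ) (μ : Measure E) [IsFiniteMeasure μ] :
    Integrable φ μ := by
  obtain ⟨C, hC⟩ := h.bounded
  exact Integrable.of_bound h.measurable.aestronglyMeasurable C (.of_forall hC)

theorem BddMeas.memLp {φ : E → ℝ} (h : BddMeas φ) (μ : Measure E) [IsFiniteMeasure μ] (p : ℝ≥0∞) :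
    MemLp φ p μ := by
  obtain ⟨C, hC⟩ := h.bounded
  exact MemLp.of_bound h.measurable.aestronglyMeasurable C (.of_forall hC)

theorem abs_integral_le_of_bound {φ : E → ℝ} {C : ℝ} (hC : ∀ x, |φ x| ≤ C)
    (μ : Measure E) [IsProbabilityMeasure μ] : |∫ x, φ x ∂μ| ≤ C := by
  simpa using norm_integral_le_of_norm_le_const (μ := μ) (f := φ) (.of_forall hC)

theorem BddMeas.integral_kernel {φ : F → ℝ} (h : BddMeas φ) (κ : Kernel E F) [IsMarkovKernel κ] :
    BddMeas fun x => ∫ y, φ y ∂κ x := by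
  obtain ⟨C, hC⟩ := h.bounded
  exact ⟨(h.measurable.stronglyMeasurable.integral_kernel (κ := κ)).measurable, C, fun x =>
    abs_integral_le_of_bound hC _⟩

theorem BddMeas.of_continuous [TopologicalSpace E] [OpensMeasurableSpace E] {φ : E → ℝ}
    (h : Continuous φ) (hb : ∃ C, ∀ x, |φ x| ≤ C) : BddMeas φ := ⟨h.measurable, hb⟩

theorem integral_bind_kernel {V : Type*} [NormedAddCommGroup V] [NormedSpace ℝ V]
    {μ : Measure E} {κ : Kernel E F} {f : F → V}
    (hf : Integrable f (μ.bind κ)) : ∫ y, f y ∂μ.bind κ = ∫ x, ∫ y, f y ∂κ x ∂μ := by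
  -- Viewing `μ` as a constant kernel makes the Fubini formula for composed kernels applicable.
  have h : μ.bind κ = (κ ∘ₖ Kernel.const Unit μ) () := by
    rw [Kernel.comp_apply, Kernel.const_apply]
  rw [h] at hf ⊢
  rw [ProbabilityTheory.Kernel.integral_comp hf, Kernel.const_apply]

end BoundedMeasurable

/-! ### Characteristic functions of normalized sums -/

/-- Factors are exchanged one at a time inside the unit disc. This lifts an estimate for one summand
to the characteristic function of `N` independent summands at the price of a factor `N`. -/
theorem norm_pow_sub_pow_le_mul {z w : ℂ} (hz : ‖z‖ ≤ 1) (hw : ‖w‖ ≤ 1) (n : ℕ) :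
    ‖z ^ n - w ^ n‖ ≤ n * ‖z - w‖ := by
  induction n with
  | zero => simp
  | succ n ih =>
    have h : z ^ (n + 1) - w ^ (n + 1) = z ^ n * (z - w) + (z ^ n - w ^ n) * w := by ring
    rw [h]
    refine (norm_add_le _ _).trans ?_
    rw [norm_mul, norm_mul, norm_pow]
    have h1 : ‖z‖ ^ n * ‖z - w‖ ≤ 1 * ‖z - w‖ :=
      mul_le_mul_of_nonneg_right (pow_le_one₀ (norm_nonneg _) hz) (norm_nonneg _)
    have h2 : ‖z ^ n - w ^ n‖ * ‖w‖ ≤ n * ‖z - w‖ * 1 :=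
      mul_le_mul ih hw (norm_nonneg _) (by positivity)
    push_cast
    linarith

theorem norm_exp_I_sub_taylor_le {x K : ℝ} (hx : |x| ≤ K) :
    ‖Complex.exp (x * Complex.I) - (1 + x * Complex.I - (x ^ 2 / 2 : ℝ))‖ ≤
      |x| ^ 3 * Real.exp K := by
  have h := Complex.norm_exp_sub_sum_le_norm_mul_exp (x * Complex.I) 3
  have hn : ‖(x * Complex.I : ℂ)‖ = |x| := by simp
  rw [hn] at h
  refine le_trans (le_of_eq ?_) (h.trans (by gcongr))
  congr 2
  simp only [Finset.sum_range_succ, Finset.sum_range_zero, mul_pow, Complex.I_sq]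
  simp [Nat.factorial]
  ring

theorem abs_exp_neg_sub_le {x K : ℝ} (hx0 : 0 ≤ x) (hx : x ≤ K) :
    |Real.exp (-x) - (1 - x)| ≤ x ^ 2 * Real.exp K := by
  have h := Complex.norm_exp_sub_sum_le_norm_mul_exp ((-x : ℝ) : ℂ) 2
  have hn : ‖((-x : ℝ) : ℂ)‖ = x := by
    rw [Complex.norm_real, Real.norm_eq_abs, abs_neg, abs_of_nonneg hx0]
  rw [hn] at h
  refine le_trans (le_of_eq ?_) (h.trans (by gcongr))
  rw [← Real.norm_eq_abs, ← Complex.norm_real]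
  congr 1
  simp only [Finset.sum_range_succ, Finset.sum_range_zero]
  simp [Nat.factorial]
  ring

/-! ### Empirical means. -/

section Mean

variable {E : Type*}

/-- The mean of `f` over the points `u i`. -/
noncomputable def mean {N : ℕ} (f : E → ℝ) (u : Fin N → E) : ℝ := (N : ℝ)⁻¹ * ∑ i, f (u i)

theorem mean_sub {N : ℕ} (f g : E → ℝ) (u : Fin N → E) :
    mean (fun x => f x - g x) u = mean f u - mean g u := by
  simp only [mean, Finset.sum_sub_distrib, mul_sub]

theorem mean_div {N : ℕ} (f : E → ℝ) (c : ℝ) (u : Fin N → E) :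
    mean (fun x => f x / c) u = mean f u / c := by
  simp only [mean, ← Finset.sum_div, mul_div_assoc]

end Mean

section CharacteristicFunction

variable {E : Type*} [MeasurableSpace E]

/-- The quantitative central limit estimate for the characteristic function of a normalized sum
of bounded centred variables. -/
theorem norm_charFun_pow_sub_exp_le (Λ : Measure E) [IsProbabilityMeasure Λ] {g : E → ℝ} {K : ℝ}
    (hg : Measurable g) (hK : ∀ x, |g x| ≤ K) (h0 : ∫ x, g x ∂Λ = 0) {N : ℕ} (hN : 1 ≤ N) :
    ‖(∫ x, Complex.exp (((√(N : ℝ))⁻¹ * g x : ℝ) * Complex.I) ∂Λ) ^ N -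
      Real.exp (-(∫ x, g x ^ 2 ∂Λ) / 2)‖ ≤
      (K ^ 3 * Real.exp K + K ^ 4 * Real.exp (K ^ 2)) * (√(N : ℝ))⁻¹ := by
  have hgb : BddMeas g := ⟨hg, K, hK⟩
  set r : ℝ := (√(N : ℝ))⁻¹ with hr
  have hN1 : (1 : ℝ) ≤ N := by exact_mod_cast hN
  have hs1 : 1 ≤ √(N : ℝ) := Real.one_le_sqrt.2 hN1
  have hr0 : 0 < r := by positivity
  have hr1 : r ≤ 1 := inv_le_one_of_one_le₀ hs1
  have hNr : (N : ℝ) * r ^ 2 = 1 := by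
    rw [hr, inv_pow, Real.sq_sqrt (by positivity)]
    exact mul_inv_cancel₀ (by positivity)
  obtain ⟨x0⟩ : Nonempty E := Λ.nonempty_of_neZero
  have hK0 : 0 ≤ K := (abs_nonneg _).trans (hK x0)
  set v : ℝ := ∫ x, g x ^ 2 ∂Λ with hv
  have hv0 : 0 ≤ v := integral_nonneg fun x => sq_nonneg _
  have hvK : v ≤ K ^ 2 := by
    refine (le_abs_self _).trans (abs_integral_le_of_bound (fun x => ?_) Λ)
    rw [abs_pow]
    exact pow_le_pow_left₀ (abs_nonneg _) (hK x) 2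
  have hm : Measurable fun x => Complex.exp ((r * g x : ℝ) * Complex.I) := by fun_prop
  have hint : Integrable (fun x => Complex.exp ((r * g x : ℝ) * Complex.I)) Λ :=
    Integrable.of_bound hm.aestronglyMeasurable 1
      (.of_forall fun x => by rw [Complex.norm_exp_ofReal_mul_I])
  have hi1 : Integrable (fun x => ((r * g x : ℝ) : ℂ) * Complex.I) Λ :=
    ((hgb.const_mul r).integrable Λ).ofReal.mul_const _
  have hi2 : Integrable (fun x => (((r * g x) ^ 2 / 2 : ℝ) : ℂ)) Λ :=
    ((((hgb.const_mul r).sq).div_const 2).integrable Λ).ofReal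
  have hi3 : Integrable (fun x => 1 + ((r * g x : ℝ) : ℂ) * Complex.I) Λ :=
    (integrable_const _).add hi1
  have hi4 : Integrable (fun x => 1 + ((r * g x : ℝ) : ℂ) * Complex.I -
      (((r * g x) ^ 2 / 2 : ℝ) : ℂ)) Λ := hi3.sub hi2
  -- The linear term drops out because `g` is centred.
  have htay : ∫ x, (1 + ((r * g x : ℝ) : ℂ) * Complex.I - (((r * g x) ^ 2 / 2 : ℝ) : ℂ)) ∂Λ =
      ((1 - r ^ 2 * v / 2 : ℝ) : ℂ) := by
    rw [integral_sub hi3 hi2, integral_add (integrable_const _) hi1,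
      integral_mul_const, integral_complex_ofReal, integral_complex_ofReal, integral_const_mul, h0,
      integral_div]
    simp_rw [mul_pow]
    rw [integral_const_mul]
    simp [← hv]
  set z := ∫ x, Complex.exp ((r * g x : ℝ) * Complex.I) ∂Λ with hz
  -- As `N r² = 1`, the power `w ^ N` is exactly the Gaussian value. Both `z` and `w` differ from `1
  -- - r² v / 2` by `O(r³)`, and passing to `N`-th powers costs `N = r⁻²`, so an error of order `r`
  -- remains.
  set w : ℂ := ((Real.exp (-(r ^ 2 * v / 2)) : ℝ) : ℂ) with hw
  have hz1 : ‖z‖ ≤ 1 := by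
    rw [hz]
    refine (norm_integral_le_of_norm_le_const (C := 1)
      (.of_forall fun x => by rw [Complex.norm_exp_ofReal_mul_I])).trans (by simp)
  have hx0' : 0 ≤ r ^ 2 * v / 2 := by positivity
  have hw1 : ‖w‖ ≤ 1 := by
    rw [hw, Complex.norm_real, Real.norm_eq_abs, abs_of_pos (Real.exp_pos _)]
    exact Real.exp_le_one_iff.2 (by linarith)
  have hwN : w ^ N = ((Real.exp (-v / 2) : ℝ) : ℂ) := by
    rw [hw, ← Complex.ofReal_pow, ← Real.exp_nat_mul]
    congr 2
    linear_combination (-v / 2) * hNr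
  have hz2 : ‖z - ((1 - r ^ 2 * v / 2 : ℝ) : ℂ)‖ ≤ r ^ 3 * (K ^ 3 * Real.exp K) := by
    rw [hz, ← htay, ← integral_sub hint hi4]
    have := norm_integral_le_of_norm_le_const (μ := Λ) (C := r ^ 3 * (K ^ 3 * Real.exp K))
      (f := fun x => Complex.exp ((r * g x : ℝ) * Complex.I) -
        (1 + ((r * g x : ℝ) : ℂ) * Complex.I - (((r * g x) ^ 2 / 2 : ℝ) : ℂ)))
      (.of_forall fun x => ?_)
    · simpa using this
    · have hb : |r * g x| ≤ r * K := by
        rw [abs_mul, abs_of_pos hr0]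
        exact mul_le_mul_of_nonneg_left (hK x) hr0.le
      have hb' : |r * g x| ≤ K := hb.trans (mul_le_of_le_one_left hK0 hr1)
      refine (norm_exp_I_sub_taylor_le hb').trans ?_
      calc |r * g x| ^ 3 * Real.exp K ≤ (r * K) ^ 3 * Real.exp K := by gcongr
        _ = _ := by ring
  have hw2 : ‖w - ((1 - r ^ 2 * v / 2 : ℝ) : ℂ)‖ ≤ r ^ 4 * (K ^ 4 * Real.exp (K ^ 2)) := by
    rw [hw, ← Complex.ofReal_sub, Complex.norm_real, Real.norm_eq_abs]
    have hle : r ^ 2 * v / 2 ≤ r ^ 2 * K ^ 2 := by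
      have := mul_le_mul_of_nonneg_left hvK (sq_nonneg r)
      linarith [mul_nonneg (sq_nonneg r) hv0]
    have hle' : r ^ 2 * v / 2 ≤ K ^ 2 :=
      hle.trans (mul_le_of_le_one_left (sq_nonneg _) (pow_le_one₀ hr0.le hr1))
    refine (abs_exp_neg_sub_le hx0' hle').trans ?_
    calc (r ^ 2 * v / 2) ^ 2 * Real.exp (K ^ 2) ≤ (r ^ 2 * K ^ 2) ^ 2 * Real.exp (K ^ 2) := by
          gcongr
      _ = _ := by ring
  rw [← hwN]
  refine (norm_pow_sub_pow_le_mul hz1 hw1 N).trans ?_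
  have hzw : ‖z - w‖ ≤ r ^ 3 * (K ^ 3 * Real.exp K) + r ^ 4 * (K ^ 4 * Real.exp (K ^ 2)) := by
    have h : z - w = (z - ((1 - r ^ 2 * v / 2 : ℝ) : ℂ)) - (w - ((1 - r ^ 2 * v / 2 : ℝ) : ℂ)) := by
      ring
    rw [h]
    exact (norm_sub_le _ _).trans (add_le_add hz2 hw2)
  calc (N : ℝ) * ‖z - w‖
      ≤ N * (r ^ 3 * (K ^ 3 * Real.exp K) + r ^ 4 * (K ^ 4 * Real.exp (K ^ 2))) := by gcongr
    _ = (N * r ^ 2) * (r * (K ^ 3 * Real.exp K) + r ^ 2 * (K ^ 4 * Real.exp (K ^ 2))) := by ring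
    _ = r * (K ^ 3 * Real.exp K) + r ^ 2 * (K ^ 4 * Real.exp (K ^ 2)) := by rw [hNr, one_mul]
    _ ≤ r * (K ^ 3 * Real.exp K) + r * (K ^ 4 * Real.exp (K ^ 2)) := by
        gcongr
        rw [pow_two]
        exact mul_le_of_le_one_left hr0.le hr1
    _ = _ := by ring

theorem BddMeas.mean {f : E → ℝ} (hf : BddMeas f) (N : ℕ) :
    BddMeas fun u : Fin N → E => mean f u :=
  (BddMeas.sum Finset.univ fun i => hf.comp (measurable_pi_apply i)).const_mul _

/-- The second moment of the error of the empirical mean of i.i.d. variables about any point. -/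
theorem integral_sq_mean_sub_le (Λ : Measure E) [IsProbabilityMeasure Λ] {g : E → ℝ} {K : ℝ}
    (hg : Measurable g) (hK : ∀ x, |g x| ≤ K) (a : ℝ) {N : ℕ} (hN : 1 ≤ N) :
    ∫ u, (mean g u - a) ^ 2 ∂(Measure.pi fun _ : Fin N => Λ) ≤
      K ^ 2 / N + (∫ x, g x ∂Λ - a) ^ 2 := by
  have hgb : BddMeas g := ⟨hg, K, hK⟩
  set P := Measure.pi fun _ : Fin N => Λ
  have hN0 : (0 : ℝ) < N := by exact_mod_cast hN
  have hS : BddMeas fun u : Fin N → E => ∑ i, g (u i) :=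
    BddMeas.sum Finset.univ fun i => hgb.comp (measurable_pi_apply i)
  have hES : ∫ u, ∑ i, g (u i) ∂P = N * ∫ x, g x ∂Λ := by
    rw [integral_finsetSum _ fun i _ => (hgb.comp (measurable_pi_apply i)).integrable P]
    have : ∀ i : Fin N, ∫ u, g (u i) ∂P = ∫ x, g x ∂Λ := fun i => by
      have hmp := measurePreserving_eval (fun _ : Fin N => Λ) i
      rw [← hmp.map_eq, integral_map (measurable_pi_apply i).aemeasurable
        hg.aestronglyMeasurable]
    simp [this]
  have hVS : Var[fun u => ∑ i, g (u i); P] ≤ N * K ^ 2 := by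
    have h := variance_sum_pi (μ := fun _ : Fin N => Λ) (X := fun _ => g)
      fun _ => hgb.memLp Λ 2
    have h' : (∑ i : Fin N, fun u : Fin N → E => g (u i)) = fun u => ∑ i, g (u i) := by
      ext u; simp
    rw [h'] at h
    rw [h]
    have hv : Var[g; Λ] ≤ K ^ 2 := by
      refine (variance_le_expectation_sq hg.aestronglyMeasurable).trans ?_
      refine (le_abs_self _).trans (abs_integral_le_of_bound (fun x => ?_) Λ)
      rw [Pi.pow_apply, abs_pow]
      exact pow_le_pow_left₀ (abs_nonneg _) (hK x) 2
    simpa using mul_le_mul_of_nonneg_left hv hN0.le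
  have hM : BddMeas fun u : Fin N → E => mean g u := hgb.mean N
  have hEM : ∫ u, mean g u ∂P = ∫ x, g x ∂Λ := by
    simp only [mean, integral_const_mul, hES]
    field_simp
  have hVM : Var[fun u => mean g u; P] ≤ K ^ 2 / N := by
    simp only [mean, variance_const_mul]
    calc ((N : ℝ)⁻¹) ^ 2 * Var[fun u => ∑ i, g (u i); P] ≤ ((N : ℝ)⁻¹) ^ 2 * (N * K ^ 2) := by
          gcongr
      _ = _ := by field_simp
  -- Bias-variance decomposition of the mean square error about `a`.
  have hsplit := variance_eq_sub ((hM.sub (BddMeas.const a)).memLp P 2)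
  have hva : Var[fun u => mean g u - a; P] = Var[fun u => mean g u; P] :=
    variance_sub_const hM.measurable.aestronglyMeasurable a
  rw [hva] at hsplit
  have hEa : ∫ u, (mean g u - a) ∂P = ∫ x, g x ∂Λ - a := by
    rw [integral_sub (hM.integrable P) (integrable_const _), hEM]
    simp
  rw [hEa] at hsplit
  have hsq : ∫ u, ((fun u => mean g u - a) ^ 2) u ∂P = ∫ u, (mean g u - a) ^ 2 ∂P := rfl
  rw [hsq] at hsplit
  linarith

/-- One step of the central limit theorem: given the law `Λ` of the independent particles, the
characteristic function of the scaled error splits into a drift and a Gaussian factor. -/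
theorem norm_integral_exp_mean_sub_le (Λ : Measure E) [IsProbabilityMeasure Λ] {f : E → ℝ} {K : ℝ}
    (hf : Measurable f) (hK : ∀ x, |f x| ≤ K) (a : ℝ) {N : ℕ} (hN : 1 ≤ N) :
    ‖∫ u, Complex.exp ((√(N : ℝ) * (mean f u - a) : ℝ) * Complex.I)
        ∂(Measure.pi fun _ : Fin N => Λ) -
      Complex.exp ((√(N : ℝ) * (∫ x, f x ∂Λ - a) : ℝ) * Complex.I) *
        Real.exp (-(∫ x, f x ^ 2 ∂Λ - (∫ x, f x ∂Λ) ^ 2) / 2)‖ ≤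
      ((2 * K) ^ 3 * Real.exp (2 * K) + (2 * K) ^ 4 * Real.exp ((2 * K) ^ 2)) *
        (√(N : ℝ))⁻¹ := by
  have hfb : BddMeas f := ⟨hf, K, hK⟩
  set b := ∫ x, f x ∂Λ with hb
  have hbK : |b| ≤ K := abs_integral_le_of_bound hK Λ
  have hN0 : (0 : ℝ) < N := by exact_mod_cast hN
  have hsq : √(N : ℝ) * √(N : ℝ) = N := Real.mul_self_sqrt hN0.le
  have hs0 : 0 < √(N : ℝ) := Real.sqrt_pos.2 hN0
  have hg0 : ∫ x, (f x - b) ∂Λ = 0 := by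
    rw [integral_sub (hfb.integrable Λ) (integrable_const _)]
    simp [hb]
  have hg2 : ∫ x, (f x - b) ^ 2 ∂Λ = ∫ x, f x ^ 2 ∂Λ - b ^ 2 := by
    have : ∀ x, (f x - b) ^ 2 = f x ^ 2 - 2 * b * f x + b ^ 2 := fun x => by ring
    simp_rw [this]
    rw [integral_add ((hfb.sq.sub (hfb.const_mul _)).integrable Λ) (integrable_const _),
      integral_sub (hfb.sq.integrable Λ) ((hfb.const_mul _).integrable Λ), integral_const_mul,
      ← hb]
    simp
    ring
  have hmain := norm_charFun_pow_sub_exp_le Λ (g := fun x => f x - b) (K := 2 * K)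
    (hf.sub measurable_const) (fun x => (abs_sub _ _).trans (by linarith [hK x])) hg0 hN
  rw [hg2] at hmain
  -- The deterministic bias `b - a` is split off as a phase; by independence the centred rest
  -- factors into `N` equal integrals.
  have hprod : ∫ u, Complex.exp ((√(N : ℝ) * (mean f u - a) : ℝ) * Complex.I)
        ∂(Measure.pi fun _ : Fin N => Λ) =
      Complex.exp ((√(N : ℝ) * (b - a) : ℝ) * Complex.I) *
      (∫ x, Complex.exp (((√(N : ℝ))⁻¹ * (f x - b) : ℝ) * Complex.I) ∂Λ) ^ N := by
    have hp := integral_fintype_prod_eq_pow (ι := Fin N) (μ := Λ) (𝕜 := ℂ)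
      (fun x => Complex.exp (((√(N : ℝ))⁻¹ * (f x - b) : ℝ) * Complex.I))
    rw [Fintype.card_fin] at hp
    rw [← hp, ← integral_const_mul]
    congr 1
    funext u
    rw [← Complex.exp_sum, ← Complex.exp_add, ← Finset.sum_mul, ← add_mul, ← Complex.ofReal_sum,
      ← Complex.ofReal_add, ← Finset.mul_sum]
    congr 3
    simp only [mean, Finset.sum_sub_distrib, Finset.sum_const, Finset.card_univ, Fintype.card_fin,
      nsmul_eq_mul]
    have h1 : (√(N : ℝ))⁻¹ = √(N : ℝ) * (N : ℝ)⁻¹ := by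
      field_simp
      linarith [hsq]
    rw [h1]
    field_simp
    ring
  rw [hprod, ← mul_sub, norm_mul, Complex.norm_exp_ofReal_mul_I, one_mul]
  exact hmain

end CharacteristicFunction

/-! ### Quantiles and the Wasserstein coupling -/

section Quantile

open Classical in
/-- The quantile function, set to `0` outside `(0,1)`, which makes it measurable. -/
noncomputable def quantileIoo (μ : Measure ℝ) (w : ℝ) : ℝ :=
  if w ∈ Set.Ioo (0 : ℝ) 1 then quantile μ w else 0

theorem quantileIoo_of_mem (μ : Measure ℝ) {w : ℝ} (hw : w ∈ Set.Ioo (0 : ℝ) 1) :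
    quantileIoo μ w = quantile μ w := if_pos hw

theorem measurable_quantileIoo_joint {α : Type*} [MeasurableSpace α] {μ : α → Measure ℝ}
    (hμ : ∀ t, Measurable fun a => cdf (μ a) t) :
    Measurable fun z : α × ℝ => quantileIoo (μ z.1) z.2 := measurable_quantile_joint μ hμ

theorem measurable_quantileIoo (μ : Measure ℝ) : Measurable (quantileIoo μ) :=
  (measurable_quantileIoo_joint (μ := fun _ : Unit => μ) fun _ => measurable_const).comp
    (measurable_prodMk_left (x := ()))

theorem wassersteinCoupling_eq_map_quantileIoo (μ ν : Measure ℝ) : wassersteinCoupling μ ν =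
    (volume.restrict (Set.Ioo (0 : ℝ) 1)).map fun w => (quantileIoo μ w, quantileIoo ν w) :=
  wassersteinCoupling_eq μ ν

instance : IsProbabilityMeasure (volume.restrict (Set.Ioo (0 : ℝ) 1)) := ⟨by simp⟩

/-- Inverse transform sampling: by `quantile_le_iff`, the preimage of `Iic t` in `(0,1)` is an
interval of length `cdf μ t`. -/
theorem map_quantileIoo (μ : Measure ℝ) [IsProbabilityMeasure μ] :
    (volume.restrict (Set.Ioo (0 : ℝ) 1)).map (quantileIoo μ) = μ := by
  have := Measure.isProbabilityMeasure_map (μ := volume.restrict (Set.Ioo (0 : ℝ) 1))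
    (measurable_quantileIoo μ).aemeasurable
  refine Measure.ext_of_Iic _ _ fun t => ?_
  rw [Measure.map_apply (measurable_quantileIoo μ) measurableSet_Iic]
  have h1 : (volume.restrict (Set.Ioo (0 : ℝ) 1)) (quantileIoo μ ⁻¹' Set.Iic t) =
      (volume.restrict (Set.Ioo (0 : ℝ) 1)) (Set.Iic (cdf μ t)) := by
    refine measure_congr ?_
    filter_upwards [ae_restrict_mem measurableSet_Ioo] with w hw
    refine propext ?_
    change quantileIoo μ w ≤ t ↔ w ≤ cdf μ t
    rw [quantileIoo_of_mem μ hw, quantile_le_iff μ hw]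
  rw [h1, Measure.restrict_congr_set Ioo_ae_eq_Ioc, Measure.restrict_apply measurableSet_Iic,
    Set.inter_comm, Set.Ioc_inter_Iic, Real.volume_Ioc, min_eq_right (cdf_le_one μ t), sub_zero,
    cdf_eq_real, ofReal_measureReal]

theorem map_fst_wassersteinCoupling (μ ν : Measure ℝ) [IsProbabilityMeasure μ] :
    (wassersteinCoupling μ ν).map Prod.fst = μ := by
  rw [wassersteinCoupling_eq_map_quantileIoo, Measure.map_map measurable_fst
    ((measurable_quantileIoo μ).prodMk (measurable_quantileIoo ν))]
  exact map_quantileIoo μ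

theorem map_snd_wassersteinCoupling (μ ν : Measure ℝ) [IsProbabilityMeasure ν] :
    (wassersteinCoupling μ ν).map Prod.snd = ν := by
  rw [wassersteinCoupling_eq_map_quantileIoo, Measure.map_map measurable_snd
    ((measurable_quantileIoo μ).prodMk (measurable_quantileIoo ν))]
  exact map_quantileIoo ν

theorem integral_wassersteinCoupling (μ ν : Measure ℝ) {h : ℝ × ℝ → ℝ} (hh : Measurable h) :
    ∫ z, h z ∂wassersteinCoupling μ ν =
      ∫ w in Set.Ioo (0 : ℝ) 1, h (quantileIoo μ w, quantileIoo ν w) := by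
  rw [wassersteinCoupling_eq_map_quantileIoo, integral_map
    ((measurable_quantileIoo μ).prodMk (measurable_quantileIoo ν)).aemeasurable
    hh.aestronglyMeasurable]

/-- Continuity of the quantile at `w` as a function of the distribution function, in quantitative
form: only two values of the distribution function matter. -/
theorem exists_quantile_near_or_cdf_far (μ : Measure ℝ)
    (hc : ContinuousOn (quantile μ) (Set.Ioo (0 : ℝ) 1)) {w : ℝ} (hw : w ∈ Set.Ioo (0 : ℝ) 1)
    {ε : ℝ} (hε : 0 < ε) : ∃ t₁ t₂ c : ℝ, 0 ≤ c ∧ ∀ ν : Measure ℝ,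
      |quantile ν w - quantile μ w| < ε ∨
        1 ≤ c * ((cdf ν t₁ - cdf μ t₁) ^ 2 + (cdf ν t₂ - cdf μ t₂) ^ 2) := by
  set a := quantile μ w with ha
  have h2 : cdf μ (a - ε / 2) < w := by
    by_contra h
    have := (quantile_le_iff μ hw (a - ε / 2)).2 (not_lt.1 h)
    linarith
  -- This strict inequality needs continuity of the quantile: if it failed, the quantile would be at
  -- least `a + ε / 2` at every level above `w`, a jump at `w`.
  have h1 : w < cdf μ (a + ε / 2) := by
    by_contra h
    have hca : ContinuousAt (quantile μ) w := hc.continuousAt (isOpen_Ioo.mem_nhds hw)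
    have hev : ∀ᶠ w' in 𝓝 w, quantile μ w' < a + ε / 2 :=
      hca.eventually (gt_mem_nhds (by linarith))
    have hev2 : ∀ᶠ w' in 𝓝[>] w, quantile μ w' < a + ε / 2 ∧ w' ∈ Set.Ioo (0 : ℝ) 1 ∧ w < w' :=
      (hev.filter_mono nhdsWithin_le_nhds).and
        ((eventually_nhdsWithin_of_eventually_nhds (isOpen_Ioo.mem_nhds hw)).and self_mem_nhdsWithin)
    obtain ⟨w', hlt, hw', hww'⟩ := hev2.exists
    have := (quantile_le_iff μ hw' (a + ε / 2)).1 hlt.le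
    exact absurd (hww'.trans_le this) h
  set d₁ := cdf μ (a + ε / 2) - w with hd₁
  set d₂ := w - cdf μ (a - ε / 2) with hd₂
  have hd₁0 : 0 < d₁ := by linarith
  have hd₂0 : 0 < d₂ := by linarith
  -- If the quantile of `ν` leaves the window, then `cdf ν` is off by at least `d₁` at the right end
  -- or by at least `d₂` at the left end.
  refine ⟨a + ε / 2, a - ε / 2, (d₁ ^ 2)⁻¹ + (d₂ ^ 2)⁻¹, by positivity, fun ν => ?_⟩
  set x := cdf ν (a + ε / 2) - cdf μ (a + ε / 2)
  set y := cdf ν (a - ε / 2) - cdf μ (a - ε / 2)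
  rcases le_or_gt (quantile ν w) (a + ε / 2) with hq1 | hq1
  · rcases le_or_gt (quantile ν w) (a - ε / 2) with hq2 | hq2
    · right
      have h := (quantile_le_iff ν hw _).1 hq2
      have hy : d₂ ≤ y := by simp only [hd₂, y]; linarith
      have hy2 : d₂ ^ 2 ≤ y ^ 2 := pow_le_pow_left₀ hd₂0.le hy 2
      calc (1 : ℝ) = (d₂ ^ 2)⁻¹ * d₂ ^ 2 := (inv_mul_cancel₀ (by positivity)).symm
        _ ≤ ((d₁ ^ 2)⁻¹ + (d₂ ^ 2)⁻¹) * (x ^ 2 + y ^ 2) := by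
          refine mul_le_mul ?_ ?_ (by positivity) (by positivity)
          · exact le_add_of_nonneg_left (by positivity)
          · linarith [sq_nonneg x]
    · left
      rw [abs_lt]
      constructor <;> linarith
  · right
    have h : cdf ν (a + ε / 2) < w := by
      by_contra h
      exact absurd ((quantile_le_iff ν hw _).2 (not_lt.1 h)) (not_le.2 hq1)
    have hx : d₁ ≤ -x := by simp only [hd₁, x]; linarith
    have hx2 : d₁ ^ 2 ≤ x ^ 2 := by
      have := pow_le_pow_left₀ hd₁0.le hx 2
      rwa [neg_sq] at this
    calc (1 : ℝ) = (d₁ ^ 2)⁻¹ * d₁ ^ 2 := (inv_mul_cancel₀ (by positivity)).symm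
      _ ≤ ((d₁ ^ 2)⁻¹ + (d₂ ^ 2)⁻¹) * (x ^ 2 + y ^ 2) := by
        refine mul_le_mul ?_ ?_ (by positivity) (by positivity)
        · exact le_add_of_nonneg_right (by positivity)
        · linarith [sq_nonneg y]

/-- Either both quantiles are so close that continuity of `h` gives `ε`, or a weighted sum of
squared errors of distribution functions is at least `1` and dominates the trivial bound `2 * K`.
The Chebyshev-type form with squares can be integrated directly over random `ν`, `ν'`. -/
theorem exists_abs_comp_quantile_sub_le (μ μ' : Measure ℝ)
    (hc : ContinuousOn (quantile μ) (Set.Ioo (0 : ℝ) 1))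
    (hc' : ContinuousOn (quantile μ') (Set.Ioo (0 : ℝ) 1)) {h : ℝ × ℝ → ℝ} (hh : Continuous h)
    {K : ℝ} (hK : ∀ z, |h z| ≤ K) {w : ℝ} (hw : w ∈ Set.Ioo (0 : ℝ) 1) {ε : ℝ} (hε : 0 < ε) :
    ∃ t₁ t₂ t₃ t₄ c : ℝ, 0 ≤ c ∧ ∀ ν ν' : Measure ℝ,
      |h (quantile ν w, quantile ν' w) - h (quantile μ w, quantile μ' w)| ≤
        ε + c * (((cdf ν t₁ - cdf μ t₁) ^ 2 + (cdf ν t₂ - cdf μ t₂) ^ 2) +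
          ((cdf ν' t₃ - cdf μ' t₃) ^ 2 + (cdf ν' t₄ - cdf μ' t₄) ^ 2)) := by
  obtain ⟨δ, hδ, hδh⟩ := Metric.continuous_iff.1 hh (quantile μ w, quantile μ' w) ε hε
  obtain ⟨t₁, t₂, c, hc0, H⟩ := exists_quantile_near_or_cdf_far μ hc hw hδ
  obtain ⟨t₃, t₄, c', hc0', H'⟩ := exists_quantile_near_or_cdf_far μ' hc' hw hδ
  have hK0 : 0 ≤ K := (abs_nonneg _).trans (hK 0)
  refine ⟨t₁, t₂, t₃, t₄, 2 * K * (c + c'), by positivity, fun ν ν' => ?_⟩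
  set X := (cdf ν t₁ - cdf μ t₁) ^ 2 + (cdf ν t₂ - cdf μ t₂) ^ 2
  set Y := (cdf ν' t₃ - cdf μ' t₃) ^ 2 + (cdf ν' t₄ - cdf μ' t₄) ^ 2
  have hX : 0 ≤ X := by positivity
  have hY : 0 ≤ Y := by positivity
  have htriv : |h (quantile ν w, quantile ν' w) - h (quantile μ w, quantile μ' w)| ≤ 2 * K :=
    (abs_sub _ _).trans ((add_le_add (hK _) (hK _)).trans_eq (two_mul K).symm)
  have hexp : (c + c') * (X + Y) = c * X + c * Y + c' * X + c' * Y := by ring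
  have hfar : 1 ≤ (c + c') * (X + Y) →
      |h (quantile ν w, quantile ν' w) - h (quantile μ w, quantile μ' w)| ≤
        ε + 2 * K * (c + c') * (X + Y) := fun h1 => by
    have := mul_le_mul_of_nonneg_left h1 (by positivity : 0 ≤ 2 * K)
    rw [mul_assoc (2 * K)]
    linarith
  have h1 : 0 ≤ c * X := by positivity
  have h2 : 0 ≤ c * Y := by positivity
  have h3 : 0 ≤ c' * X := by positivity
  have h4 : 0 ≤ c' * Y := by positivity
  rcases H ν with h | h
  · rcases H' ν' with h' | h'
    · have hd : dist (quantile ν w, quantile ν' w) (quantile μ w, quantile μ' w) < δ := by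
        rw [Prod.dist_eq, max_lt_iff, Real.dist_eq, Real.dist_eq]
        exact ⟨h, h'⟩
      have := (hδh _ hd).le
      rw [Real.dist_eq] at this
      have : 0 ≤ 2 * K * (c + c') * (X + Y) := by positivity
      linarith
    · exact hfar (by linarith)
  · exact hfar (by linarith)

/-- If the distribution functions of random measures converge pointwise in mean square to those of
measures with continuous quantile functions, then the Wasserstein couplings converge weakly, in
the mean. -/
theorem tendsto_integral_abs_wassersteinCoupling_sub {Ω : ℕ → Type*}
    [∀ N, MeasurableSpace (Ω N)] (P : ∀ N, Measure (Ω N)) [∀ N, IsProbabilityMeasure (P N)]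
    (ν ν' : ∀ N, Ω N → Measure ℝ) (μ μ' : Measure ℝ)
    (hν : ∀ N t, Measurable fun ω => cdf (ν N ω) t)
    (hν' : ∀ N t, Measurable fun ω => cdf (ν' N ω) t)
    (hc : ContinuousOn (quantile μ) (Set.Ioo (0 : ℝ) 1))
    (hc' : ContinuousOn (quantile μ') (Set.Ioo (0 : ℝ) 1))
    (hlim : ∀ t, Tendsto (fun N => ∫ ω, (cdf (ν N ω) t - cdf μ t) ^ 2 ∂P N) atTop (𝓝 0))
    (hlim' : ∀ t, Tendsto (fun N => ∫ ω, (cdf (ν' N ω) t - cdf μ' t) ^ 2 ∂P N) atTop (𝓝 0))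
    {h : ℝ × ℝ → ℝ} (hh : Continuous h) {K : ℝ} (hK : ∀ z, |h z| ≤ K) :
    Tendsto (fun N => ∫ ω, |∫ z, h z ∂wassersteinCoupling (ν N ω) (ν' N ω) -
      ∫ z, h z ∂wassersteinCoupling μ μ'| ∂P N) atTop (𝓝 0) := by
  set U := volume.restrict (Set.Ioo (0 : ℝ) 1) with hU
  let g : ∀ N, Ω N × ℝ → ℝ := fun N z =>
    h (quantileIoo (ν N z.1) z.2, quantileIoo (ν' N z.1) z.2) -
      h (quantileIoo μ z.2, quantileIoo μ' z.2)
  have hgK : ∀ N z, |g N z| ≤ 2 * K := fun N z =>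
    (abs_sub _ _).trans ((add_le_add (hK _) (hK _)).trans_eq (two_mul K).symm)
  have hgm : ∀ N, Measurable (g N) := fun N =>
    (hh.measurable.comp ((measurable_quantileIoo_joint (hν N)).prodMk
      (measurable_quantileIoo_joint (hν' N)))).sub
    (hh.measurable.comp (((measurable_quantileIoo μ).comp measurable_snd).prodMk
      ((measurable_quantileIoo μ').comp measurable_snd)))
  have hgb : ∀ N, BddMeas (g N) := fun N => ⟨hgm N, 2 * K, hgK N⟩
  have hsqb : ∀ (N : ℕ) (ρ : Ω N → Measure ℝ) (t d : ℝ), (Measurable fun ω => cdf (ρ ω) t) →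
      BddMeas fun ω => (cdf (ρ ω) t - d) ^ 2 := fun N ρ t d hm =>
    (BddMeas.sub ⟨hm, 1, fun ω => by
      rw [abs_of_nonneg (cdf_nonneg _ _)]; exact cdf_le_one _ _⟩ (BddMeas.const d)).sq
  -- Only finitely many values of the distribution functions enter at a fixed `w`, so pointwise
  -- convergence of these suffices; dominated convergence then integrates over `w`.
  have hpt : ∀ w ∈ Set.Ioo (0 : ℝ) 1,
      Tendsto (fun N => ∫ ω, |g N (ω, w)| ∂P N) atTop (𝓝 0) := by
    intro w hw
    refine Metric.tendsto_atTop.2 fun ε hε => ?_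
    obtain ⟨t₁, t₂, t₃, t₄, c, hc0, H⟩ :=
      exists_abs_comp_quantile_sub_le μ μ' hc hc' hh hK hw (half_pos hε)
    have hl := (((hlim t₁).add (hlim t₂)).add ((hlim' t₃).add (hlim' t₄))).const_mul c
    simp only [add_zero, mul_zero] at hl
    obtain ⟨N₀, hN₀⟩ := Metric.tendsto_atTop.1 hl (ε / 2) (half_pos hε)
    refine ⟨N₀, fun N hN => ?_⟩
    have hN' := hN₀ N hN
    rw [Real.dist_eq, sub_zero] at hN' ⊢
    rw [abs_of_nonneg (integral_nonneg fun _ => abs_nonneg _)]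
    have i1 := hsqb N (ν N) t₁ (cdf μ t₁) (hν N t₁)
    have i2 := hsqb N (ν N) t₂ (cdf μ t₂) (hν N t₂)
    have i3 := hsqb N (ν' N) t₃ (cdf μ' t₃) (hν' N t₃)
    have i4 := hsqb N (ν' N) t₄ (cdf μ' t₄) (hν' N t₄)
    have hle : ∫ ω, |g N (ω, w)| ∂P N ≤ ∫ ω, (ε / 2 + c *
        (((cdf (ν N ω) t₁ - cdf μ t₁) ^ 2 + (cdf (ν N ω) t₂ - cdf μ t₂) ^ 2) +
          ((cdf (ν' N ω) t₃ - cdf μ' t₃) ^ 2 + (cdf (ν' N ω) t₄ - cdf μ' t₄) ^ 2))) ∂P N := by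
      refine integral_mono (((hgb N).comp measurable_prodMk_right).abs.integrable _)
        (((BddMeas.const _).add (((i1.add i2).add (i3.add i4)).const_mul c)).integrable _)
        fun ω => ?_
      simp only [g, quantileIoo_of_mem _ hw]
      exact H _ _
    rw [integral_add (integrable_const _) ((((i1.add i2).add (i3.add i4)).const_mul c).integrable _),
      integral_const_mul, integral_add ((i1.add i2).integrable _) ((i3.add i4).integrable _),
      integral_add (i1.integrable _) (i2.integrable _),
      integral_add (i3.integrable _) (i4.integrable _)] at hle
    simp only [integral_const, probReal_univ, one_smul] at hle
    have := (le_abs_self _).trans_lt hN'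
    linarith
  have hdct : Tendsto (fun N => ∫ w, ∫ ω, |g N (ω, w)| ∂P N ∂U) atTop (𝓝 0) := by
    have := tendsto_integral_of_dominated_convergence (μ := U)
      (F := fun N w => ∫ ω, |g N (ω, w)| ∂P N) (f := fun _ => 0) (fun _ => 2 * K)
      (fun N => ((hgm N).abs.stronglyMeasurable.integral_prod_left').aestronglyMeasurable)
      (integrable_const _)
      (fun N => .of_forall fun w => by
        rw [Real.norm_eq_abs]
        exact abs_integral_le_of_bound (fun ω => by rw [abs_abs]; exact hgK N _) _)
      ((ae_restrict_mem measurableSet_Ioo).mono hpt)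
    simpa using this
  refine squeeze_zero (fun N => integral_nonneg fun _ => abs_nonneg _) (fun N => ?_) hdct
  -- Fubini turns the iterated integral over `w` and `ω` into a bound for the mean error of the
  -- coupling.
  rw [← integral_integral_swap ((hgb N).abs.integrable ((P N).prod U))]
  refine integral_mono_of_nonneg (.of_forall fun ω => abs_nonneg _)
    ((hgb N).abs.integrable ((P N).prod U)).integral_prod_left (.of_forall fun ω => ?_)
  have hhb : BddMeas h := ⟨hh.measurable, K, hK⟩
  have hq := fun ρ ρ' : Measure ℝ =>
    (measurable_quantileIoo ρ).prodMk (measurable_quantileIoo ρ')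
  simp only [integral_wassersteinCoupling _ _ hh.measurable]
  rw [← integral_sub ((hhb.comp (hq _ _)).integrable _) ((hhb.comp (hq _ _)).integrable _)]
  exact abs_integral_le_integral_abs

end Quantile

/-- The coordinate of a pair that belongs to the given level. -/
def proj : Level → ℝ × ℝ → ℝ
  | Level.f => Prod.fst
  | Level.c => Prod.snd

theorem measurable_proj (s : Level) : Measurable (proj s) := by
  cases s
  exacts [measurable_fst, measurable_snd]

namespace CoupledModel

variable (m : CoupledModel)

/-! ### Feynman-Kac flows -/

theorem bddMeas_G (n : ℕ) : BddMeas (m.G n) := by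
  obtain ⟨C, hC⟩ := m.G_bounded n
  exact ⟨m.G_measurable n, C, fun x => by rw [abs_of_nonneg (m.G_nonneg n x)]; exact hC x⟩

theorem bddMeas_G_mul_integral {φ : ℝ → ℝ} (h : BddMeas φ) (s : Level) (n k : ℕ) :
    BddMeas fun x => m.G n x * ∫ y, φ y ∂m.M s k x :=
  (m.bddMeas_G n).mul (h.integral_kernel _)

instance isFiniteMeasure_withDensity_G (μ : Measure ℝ) [IsFiniteMeasure μ] (n : ℕ) :
    IsFiniteMeasure (μ.withDensity fun x => ENNReal.ofReal (m.G n x)) :=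
  isFiniteMeasure_withDensity_ofReal ((m.bddMeas_G n).integrable μ).2

instance isFiniteMeasure_gam (s : Level) (n : ℕ) : IsFiniteMeasure (m.gam s n) := by
  induction n with
  | zero => exact inferInstanceAs (IsFiniteMeasure (m.init s))
  | succ n ih =>
    rw [gam]
    infer_instance

theorem integral_withDensity_G (μ : Measure ℝ) (n : ℕ) (φ : ℝ → ℝ) :
    ∫ x, φ x ∂(μ.withDensity fun x => ENNReal.ofReal (m.G n x)) = ∫ x, m.G n x * φ x ∂μ := by
  rw [integral_withDensity_eq_integral_toReal_smul (m.G_measurable n).ennreal_ofReal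
    (.of_forall fun _ => ENNReal.ofReal_lt_top)]
  simp only [ENNReal.toReal_ofReal (m.G_nonneg n _), smul_eq_mul]

theorem integral_gam_succ (s : Level) (n : ℕ) {φ : ℝ → ℝ} (h : BddMeas φ) :
    ∫ x, φ x ∂m.gam s (n + 1) = ∫ x, m.G n x * ∫ y, φ y ∂m.M s (n + 1) x ∂m.gam s n := by
  rw [gam, integral_bind_kernel (h.integrable _), integral_withDensity_G]

theorem integral_eta (s : Level) (n : ℕ) (φ : ℝ → ℝ) :
    ∫ x, φ x ∂m.eta s n = (∫ x, φ x ∂m.gam s n) / (m.gam s n).real Set.univ := by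
  rw [eta, integral_smul_measure, ENNReal.toReal_inv, smul_eq_mul, Measure.real, div_eq_inv_mul]

variable {m}

section Positive

variable (hpos : ∀ (s : Level) (n : ℕ), 0 < ∫ x, m.G n x ∂m.eta s n)
include hpos

/-- A vanishing `gam` would make `eta` the zero measure, for which the integral in `hpos` is `0`. -/
theorem gam_univ_ne_zero (s : Level) (n : ℕ) : m.gam s n Set.univ ≠ 0 := by
  intro h
  have h0 : m.gam s n = 0 := Measure.measure_univ_eq_zero.1 h
  have := hpos s n
  rw [eta, h0, smul_zero, integral_zero_measure] at this
  exact lt_irrefl _ this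

theorem gam_real_univ_pos (s : Level) (n : ℕ) : 0 < (m.gam s n).real Set.univ :=
  ENNReal.toReal_pos (gam_univ_ne_zero hpos s n) (measure_ne_top _ _)

theorem isProbabilityMeasure_eta (s : Level) (n : ℕ) : IsProbabilityMeasure (m.eta s n) := by
  refine ⟨?_⟩
  rw [eta, Measure.smul_apply, smul_eq_mul,
    ENNReal.inv_mul_cancel (gam_univ_ne_zero hpos s n) (measure_ne_top _ _)]

/-- The one-step recursion of the predictors: the normalizing constants cancel since `γ_{n+1}(1) =
γ_n(G_n)`. -/
theorem integral_eta_succ_mul (s : Level) (n : ℕ) {φ : ℝ → ℝ} (h : BddMeas φ) :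
    (∫ x, φ x ∂m.eta s (n + 1)) * ∫ x, m.G n x ∂m.eta s n =
      ∫ x, m.G n x * ∫ y, φ y ∂m.M s (n + 1) x ∂m.eta s n := by
  have h1 := m.integral_gam_succ s n (BddMeas.const 1)
  simp only [integral_const, probReal_univ, smul_eq_mul, mul_one] at h1
  have hZ := gam_real_univ_pos hpos s n
  have hZ' := gam_real_univ_pos hpos s (n + 1)
  rw [integral_eta, integral_eta, integral_eta, ← m.integral_gam_succ s n h, ← h1]
  field_simp

theorem lintegral_G_eta (s : Level) (n : ℕ) :
    ∫⁻ x, ENNReal.ofReal (m.G n x) ∂m.eta s n = ENNReal.ofReal (∫ x, m.G n x ∂m.eta s n) := by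
  have := isProbabilityMeasure_eta hpos s n
  rw [ofReal_integral_eq_lintegral_ofReal ((m.bddMeas_G n).integrable _)
    (.of_forall (m.G_nonneg n))]

theorem integral_etaBar_mul (s : Level) (n : ℕ) (φ : ℝ → ℝ) :
    (∫ x, φ x ∂m.etaBar s n) * ∫ x, m.G n x ∂m.eta s n = ∫ x, m.G n x * φ x ∂m.eta s n := by
  have hb := hpos s n
  rw [etaBar, integral_smul_measure, lintegral_G_eta hpos, ENNReal.toReal_inv,
    ENNReal.toReal_ofReal hb.le, integral_withDensity_G, smul_eq_mul]
  field_simp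

theorem isProbabilityMeasure_etaBar (s : Level) (n : ℕ) : IsProbabilityMeasure (m.etaBar s n) := by
  have := isProbabilityMeasure_eta hpos s n
  refine ⟨?_⟩
  rw [etaBar, Measure.smul_apply, withDensity_apply _ MeasurableSet.univ, setLIntegral_univ,
    smul_eq_mul, lintegral_G_eta hpos]
  exact ENNReal.inv_mul_cancel (ENNReal.ofReal_pos.2 (hpos s n)).ne' ENNReal.ofReal_ne_top

end Positive

/-! ### Marginals of the couplings -/

theorem map_Mc (m : CoupledModel) (s : Level) (n : ℕ) (hn : 1 ≤ n) (u : ℝ × ℝ) :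
    (m.Mc n u).map (proj s) = m.M s n (proj s u) := by
  ext A hA
  rw [Measure.map_apply (measurable_proj s) hA]
  cases s
  · refine Eq.trans ?_ (m.Mc_fst n hn u A hA)
    congr 1
    ext z
    simp [proj]
  · refine Eq.trans ?_ (m.Mc_snd n hn u A hA)
    congr 1
    ext z
    simp [proj]

theorem map_proj_wassersteinCoupling (s : Level) (μ : Level → Measure ℝ)
    [IsProbabilityMeasure (μ s)] :
    (wassersteinCoupling (μ Level.f) (μ Level.c)).map (proj s) = μ s := by
  cases s
  exacts [map_fst_wassersteinCoupling _ _, map_snd_wassersteinCoupling _ _]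

theorem integral_PhiW (m : CoupledModel) (n : ℕ) (μ ν : Measure ℝ) {h : ℝ × ℝ → ℝ}
    (hh : BddMeas h) : ∫ z, h z ∂m.PhiW n μ ν =
      ∫ u, ∫ z, h z ∂m.Mc n u ∂wassersteinCoupling μ ν := by
  rw [PhiW, integral_bind_kernel]
  exact hh.integrable (m.PhiW n μ ν)

/-- Both ingredients, the quantile coupling and the kernel `Mc`, have the prescribed marginals, so
on functions of one coordinate the coupling disappears. Only the level under consideration has to
carry a probability measure. -/
theorem integral_proj_PhiW (m : CoupledModel) (s : Level) (n : ℕ) (hn : 1 ≤ n)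
    (μ : Level → Measure ℝ) [IsProbabilityMeasure (μ s)] {φ : ℝ → ℝ} (h : BddMeas φ) :
    ∫ z, φ (proj s z) ∂m.PhiW n (μ Level.f) (μ Level.c) =
      ∫ x, ∫ y, φ y ∂m.M s n x ∂μ s := by
  rw [m.integral_PhiW n _ _ (h.comp (measurable_proj s))]
  have h1 : ∀ u, ∫ z, φ (proj s z) ∂m.Mc n u = ∫ y, φ y ∂m.M s n (proj s u) := fun u => by
    rw [← m.map_Mc s n hn u, integral_map (measurable_proj s).aemeasurable
      h.measurable.aestronglyMeasurable]
  simp_rw [h1]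
  conv_rhs => rw [← map_proj_wassersteinCoupling s μ]
  rw [integral_map (measurable_proj s).aemeasurable
    (h.integral_kernel (m.M s n)).measurable.aestronglyMeasurable]

instance isProbabilityMeasure_etaW (n : ℕ) : IsProbabilityMeasure (m.etaW n) := by
  cases n with
  | zero => exact m.initc_prob
  | succ n => exact inferInstanceAs (IsProbabilityMeasure (m.PhiW _ _ _))

theorem map_initc (m : CoupledModel) (s : Level) : m.initc.map (proj s) = m.init s := by
  ext A hA
  rw [Measure.map_apply (measurable_proj s) hA]
  cases s
  · rw [← m.initc_fst A hA]
    congr 1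
    ext z
    simp [proj]
  · rw [← m.initc_snd A hA]
    congr 1
    ext z
    simp [proj]

theorem eta_zero (m : CoupledModel) (s : Level) : m.eta s 0 = m.init s := by
  simp [eta, gam]

theorem integral_proj_etaW (hpos : ∀ (s : Level) (n : ℕ), 0 < ∫ x, m.G n x ∂m.eta s n)
    (s : Level) (n : ℕ) {φ : ℝ → ℝ} (h : BddMeas φ) :
    ∫ z, φ (proj s z) ∂m.etaW n = ∫ x, φ x ∂m.eta s n := by
  -- No induction is needed: `etaW (n + 1)` is built from the exact filters at time `n`, not from
  -- `etaW n`.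
  cases n with
  | zero =>
    rw [eta_zero, ← map_initc, integral_map (measurable_proj s).aemeasurable
      h.measurable.aestronglyMeasurable, etaW]
  | succ n =>
    have := isProbabilityMeasure_etaBar hpos s n
    rw [etaW, m.integral_proj_PhiW s (n + 1) n.succ_pos (fun s => m.etaBar s n) h]
    have h1 := integral_etaBar_mul hpos s n fun x => ∫ y, φ y ∂m.M s (n + 1) x
    rw [← integral_eta_succ_mul hpos s n h] at h1
    exact mul_right_cancel₀ (hpos s n).ne' h1

theorem bddMeas_diff {φ ψ : ℝ → ℝ} (h : BddMeas φ) (h' : BddMeas ψ) :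
    BddMeas fun u : ℝ × ℝ => φ u.1 - ψ u.2 := (h.comp measurable_fst).sub (h'.comp measurable_snd)

theorem integral_diff_etaW (hpos : ∀ (s : Level) (n : ℕ), 0 < ∫ x, m.G n x ∂m.eta s n)
    (n : ℕ) {φ ψ : ℝ → ℝ} (h : BddMeas φ) (h' : BddMeas ψ) :
    ∫ u, (φ u.1 - ψ u.2) ∂m.etaW n = ∫ x, φ x ∂m.eta Level.f n - ∫ x, ψ x ∂m.eta Level.c n := by
  rw [integral_sub ((h.comp measurable_fst).integrable _) ((h'.comp measurable_snd).integrable _),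
    ← integral_proj_etaW hpos Level.f n h, ← integral_proj_etaW hpos Level.c n h']
  rfl

/-! ### The Feynman-Kac semigroups -/

theorem bddMeas_Qsg (m : CoupledModel) (s : Level) (k : ℕ) : ∀ (p : ℕ) {φ : ℝ → ℝ}, BddMeas φ →
    BddMeas (m.Qsg s p k φ) := by
  induction k with
  | zero => exact fun p φ h => h
  | succ k ih => exact fun p φ h => m.bddMeas_G_mul_integral (ih (p + 1) h) s p (p + 1)

/-- The definition peels off the first time step, whereas the induction on the final time has to
peel off the last one. -/
theorem Qsg_succ_right (m : CoupledModel) (s : Level) (k : ℕ) : ∀ (p : ℕ) (φ : ℝ → ℝ),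
    m.Qsg s p (k + 1) φ =
      m.Qsg s p k fun x => m.G (p + k) x * ∫ y, φ y ∂m.M s (p + k + 1) x := by
  induction k with
  | zero => exact fun p φ => rfl
  | succ k ih =>
    intro p φ
    rw [Qsg, ih (p + 1) φ, show p + 1 + k = p + (k + 1) by ring]
    rfl

theorem integral_Qsg_gam (m : CoupledModel) (s : Level) (k : ℕ) : ∀ (p : ℕ) {φ : ℝ → ℝ},
    BddMeas φ → ∫ x, m.Qsg s p k φ x ∂m.gam s p = ∫ x, φ x ∂m.gam s (p + k) := by
  induction k with
  | zero => exact fun p φ h => rfl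
  | succ k ih =>
    intro p φ h
    simp only [Qsg]
    rw [← m.integral_gam_succ s p (m.bddMeas_Qsg s k (p + 1) h), ih (p + 1) h,
      show p + 1 + k = p + (k + 1) by ring]

theorem Qsg_sum (m : CoupledModel) (s : Level) {ι : Type*} (S : Finset ι) (t : ι → ℝ)
    {φ : ι → ℝ → ℝ} (h : ∀ i, BddMeas (φ i)) (k : ℕ) : ∀ p : ℕ,
    m.Qsg s p k (fun x => ∑ i ∈ S, t i * φ i x) = fun x => ∑ i ∈ S, t i * m.Qsg s p k (φ i) x := by
  induction k with
  | zero => exact fun p => rfl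
  | succ k ih =>
    intro p
    funext x
    simp only [Qsg, ih (p + 1)]
    rw [integral_finsetSum S fun i _ =>
      ((m.bddMeas_Qsg s k (p + 1) (h i)).const_mul (t i)).integrable _, Finset.mul_sum]
    refine Finset.sum_congr rfl fun i _ => ?_
    rw [integral_const_mul]
    ring

theorem Qsg_const_mul (m : CoupledModel) (s : Level) (k : ℕ) (c : ℝ) (φ : ℝ → ℝ) : ∀ p : ℕ,
    m.Qsg s p k (fun x => c * φ x) = fun x => c * m.Qsg s p k φ x := by
  induction k with
  | zero => exact fun p => rfl
  | succ k ih =>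
    intro p
    funext x
    simp only [Qsg, ih (p + 1), integral_const_mul]
    ring

theorem bddMeas_D (m : CoupledModel) (s : Level) (p n : ℕ) {φ : ℝ → ℝ} (h : BddMeas φ) :
    BddMeas (m.D s p n φ) :=
  (m.bddMeas_Qsg s (n - p) p (h.sub (BddMeas.const _))).div_const _

/-- The function `G_n M_{n+1}(φ - η_{n+1}(φ)) / η_n(G_n)`, whose scaled error at time `n`
carries the scaled error of `φ` at time `n + 1`, up to the sampling error. -/
noncomputable def pull (m : CoupledModel) (s : Level) (n : ℕ) (φ : ℝ → ℝ) (x : ℝ) : ℝ :=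
  (m.G n x * ∫ y, (φ y - ∫ z, φ z ∂m.eta s (n + 1)) ∂m.M s (n + 1) x) / ∫ z, m.G n z ∂m.eta s n

theorem bddMeas_pull (m : CoupledModel) (s : Level) (n : ℕ) {φ : ℝ → ℝ} (h : BddMeas φ) :
    BddMeas (m.pull s n φ) :=
  (m.bddMeas_G_mul_integral (h.sub (BddMeas.const _)) s n (n + 1)).div_const _

section Positive

variable (hpos : ∀ (s : Level) (n : ℕ), 0 < ∫ x, m.G n x ∂m.eta s n)
include hpos

theorem integral_G_mul_integral_centred (s : Level) (n : ℕ) {φ : ℝ → ℝ} (h : BddMeas φ) :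
    ∫ x, m.G n x * ∫ y, (φ y - ∫ z, φ z ∂m.eta s (n + 1)) ∂m.M s (n + 1) x ∂m.eta s n = 0 := by
  have := isProbabilityMeasure_eta hpos s (n + 1)
  rw [← integral_eta_succ_mul hpos s n (h.sub (BddMeas.const _)),
    integral_sub (h.integrable _) (integrable_const _)]
  simp

theorem integral_pull (s : Level) (n : ℕ) {φ : ℝ → ℝ} (h : BddMeas φ) :
    ∫ x, m.pull s n φ x ∂m.eta s n = 0 := by
  simp only [pull]
  rw [integral_div, integral_G_mul_integral_centred hpos s n h, zero_div]

/-- By the semigroup property the last step of `Q` acts on the centred `φ` as `η_n(G_n)` times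
`pull`, and the normalization grows by the same factor `η_n(G_n)`, which cancels. The function
`pull` is already centred under `η_n`, so `D` subtracts nothing further. -/
theorem D_succ (s : Level) {p n : ℕ} (hp : p ≤ n) {φ : ℝ → ℝ} (h : BddMeas φ) :
    m.D s p (n + 1) φ = m.D s p n (m.pull s n φ) := by
  obtain ⟨k, rfl⟩ := Nat.exists_eq_add_of_le hp
  set b := ∫ x, m.G (p + k) x ∂m.eta s (p + k) with hb
  have hb0 : 0 < b := hpos s (p + k)
  funext x
  simp only [D, Q, integral_pull hpos s (p + k) h, sub_zero]
  rw [show p + k + 1 - p = k + 1 by omega, show p + k - p = k by omega, Qsg_succ_right,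
    Qsg_succ_right]
  have h1 : (fun x => m.G (p + k) x *
      ∫ y, (φ y - ∫ z, φ z ∂m.eta s (p + k + 1)) ∂m.M s (p + k + 1) x) =
      fun x => b * m.pull s (p + k) φ x := by
    funext x
    rw [pull, mul_div_cancel₀ _ hb0.ne']
  have h2 : ∫ z, m.Qsg s p k (fun x => m.G (p + k) x *
      ∫ _, (1 : ℝ) ∂m.M s (p + k + 1) x) z ∂m.eta s p =
        b * ∫ z, m.Qsg s p k (fun _ => 1) z ∂m.eta s p := by
    rw [integral_eta, integral_eta,
      m.integral_Qsg_gam s k p (m.bddMeas_G_mul_integral (BddMeas.const 1) s _ _),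
      m.integral_Qsg_gam s k p (BddMeas.const 1), hb, integral_eta]
    have hZ := gam_real_univ_pos hpos s (p + k)
    simp only [integral_const, probReal_univ, smul_eq_mul, mul_one]
    field_simp
  rw [h1, h2, Qsg_const_mul, mul_div_mul_left _ _ hb0.ne']

theorem D_self (s : Level) (n : ℕ) (φ : ℝ → ℝ) (x : ℝ) :
    m.D s n n φ x = φ x - ∫ z, φ z ∂m.eta s n := by
  have := isProbabilityMeasure_eta hpos s n
  simp [D, Q, Qsg]

theorem D_sum (s : Level) {ι : Type*} (S : Finset ι) (t : ι → ℝ) {φ : ι → ℝ → ℝ}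
    (h : ∀ i, BddMeas (φ i)) (p n : ℕ) (x : ℝ) :
    m.D s p n (fun y => ∑ i ∈ S, t i * φ i y) x = ∑ i ∈ S, t i * m.D s p n (φ i) x := by
  have := isProbabilityMeasure_eta hpos s n
  have h1 : (fun y => ∑ i ∈ S, t i * φ i y - ∫ z, ∑ i ∈ S, t i * φ i z ∂m.eta s n) =
      fun y => ∑ i ∈ S, t i * (φ i y - ∫ z, φ i z ∂m.eta s n) := by
    funext y
    rw [integral_finsetSum S fun i _ => ((h i).const_mul (t i)).integrable _,
      ← Finset.sum_sub_distrib]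
    refine Finset.sum_congr rfl fun i _ => ?_
    rw [integral_const_mul, mul_sub]
  simp only [D, Q]
  rw [h1, m.Qsg_sum s S t (fun i => (h i).sub (BddMeas.const _)), Finset.sum_div]
  exact Finset.sum_congr rfl fun i _ => mul_div_assoc _ _ _

end Positive

/-! ### The asymptotic variance -/

/-- The asymptotic variance of the scaled error of `φ ⊗ 1 - 1 ⊗ ψ`. -/
noncomputable def asympVar (m : CoupledModel) (n : ℕ) (φ ψ : ℝ → ℝ) : ℝ :=
  ∑ p ∈ Finset.range (n + 1),
    ∫ u, (m.D Level.f p n φ u.1 - m.D Level.c p n ψ u.2) ^ 2 ∂m.etaW p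

/-- For `p = n` the operator `D` merely centres, so the last term of `asympVar` is the sampling
variance under `etaW n`. -/
theorem integral_sq_D_self_diff (hpos : ∀ (s : Level) (n : ℕ), 0 < ∫ x, m.G n x ∂m.eta s n)
    (n : ℕ) {φ ψ : ℝ → ℝ} (h : BddMeas φ) (h' : BddMeas ψ) :
    ∫ u, (m.D Level.f n n φ u.1 - m.D Level.c n n ψ u.2) ^ 2 ∂m.etaW n =
      ∫ u, (φ u.1 - ψ u.2) ^ 2 ∂m.etaW n - (∫ u, (φ u.1 - ψ u.2) ∂m.etaW n) ^ 2 := by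
  have hf := bddMeas_diff h h'
  have hv := variance_eq_sub (hf.memLp (m.etaW n) 2)
  rw [variance_eq_integral hf.measurable.aemeasurable] at hv
  simp only [Pi.pow_apply] at hv
  rw [← hv, integral_diff_etaW hpos n h h']
  refine integral_congr_ae (.of_forall fun u => ?_)
  simp only [D_self hpos]
  ring

theorem asympVar_zero (hpos : ∀ (s : Level) (n : ℕ), 0 < ∫ x, m.G n x ∂m.eta s n)
    {φ ψ : ℝ → ℝ} (h : BddMeas φ) (h' : BddMeas ψ) :
    m.asympVar 0 φ ψ =
      ∫ u, (φ u.1 - ψ u.2) ^ 2 ∂m.etaW 0 - (∫ u, (φ u.1 - ψ u.2) ∂m.etaW 0) ^ 2 := by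
  rw [asympVar, Finset.sum_range_one, integral_sq_D_self_diff hpos 0 h h']

/-- The variance recursion matching the induction on time: the terms `p ≤ n` are inherited through
`D_succ`, the term `p = n + 1` is fresh sampling noise. -/
theorem asympVar_succ (hpos : ∀ (s : Level) (n : ℕ), 0 < ∫ x, m.G n x ∂m.eta s n)
    (n : ℕ) {φ ψ : ℝ → ℝ} (h : BddMeas φ) (h' : BddMeas ψ) :
    m.asympVar (n + 1) φ ψ = m.asympVar n (m.pull Level.f n φ) (m.pull Level.c n ψ) +
      (∫ u, (φ u.1 - ψ u.2) ^ 2 ∂m.etaW (n + 1) -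
        (∫ u, (φ u.1 - ψ u.2) ∂m.etaW (n + 1)) ^ 2) := by
  rw [asympVar, Finset.sum_range_succ, integral_sq_D_self_diff hpos (n + 1) h h', asympVar]
  congr 1
  refine Finset.sum_congr rfl fun p hp => ?_
  rw [D_succ hpos Level.f (Finset.mem_range_succ_iff.1 hp) h,
    D_succ hpos Level.c (Finset.mem_range_succ_iff.1 hp) h']

/-- The quadratic form of the asymptotic covariance matrix is the asymptotic variance of the
corresponding linear combination. -/
theorem sum_asympCov_eq_asympVar (hpos : ∀ (s : Level) (n : ℕ), 0 < ∫ x, m.G n x ∂m.eta s n)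
    (n : ℕ) {q : ℕ} {φ ψ : Fin q → ℝ → ℝ} (h : ∀ i, BddMeas (φ i)) (h' : ∀ i, BddMeas (ψ i))
    (t : Fin q → ℝ) :
    ∑ i, t i * ∑ j, m.asympCov n φ ψ i j * t j =
      m.asympVar n (fun x => ∑ i, t i * φ i x) (fun x => ∑ i, t i * ψ i x) := by
  have hD : ∀ p i, BddMeas fun u : ℝ × ℝ =>
      m.D Level.f p n (φ i) u.1 - m.D Level.c p n (ψ i) u.2 := fun p i =>
    bddMeas_diff (m.bddMeas_D _ p n (h i)) (m.bddMeas_D _ p n (h' i))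
  simp only [asympCov, Matrix.of_apply, asympVar, D_sum hpos _ Finset.univ t h,
    D_sum hpos _ Finset.univ t h', ← Finset.sum_sub_distrib, ← mul_sub]
  simp only [Finset.sum_mul, Finset.mul_sum]
  rw [Finset.sum_congr rfl fun i _ => Finset.sum_comm, Finset.sum_comm]
  refine Finset.sum_congr rfl fun p _ => ?_
  simp only [pow_two, Finset.sum_mul, Finset.mul_sum]
  rw [integral_finsetSum _ fun i _ => (BddMeas.sum Finset.univ fun j =>
    ((hD p _).const_mul _).mul ((hD p _).const_mul _)).integrable _]
  refine Finset.sum_congr rfl fun i _ => ?_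
  rw [integral_finsetSum _ fun j _ =>
    (((hD p _).const_mul _).mul ((hD p _).const_mul _)).integrable _]
  refine Finset.sum_congr rfl fun j _ => ?_
  rw [← integral_mul_const, ← integral_const_mul]
  exact integral_congr_ae (.of_forall fun u => by ring)

theorem posSemidef_asympCov (hpos : ∀ (s : Level) (n : ℕ), 0 < ∫ x, m.G n x ∂m.eta s n)
    (n : ℕ) {q : ℕ} {φ ψ : Fin q → ℝ → ℝ} (h : ∀ i, BddMeas (φ i)) (h' : ∀ i, BddMeas (ψ i)) :
    (m.asympCov n φ ψ).PosSemidef := by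
  refine Matrix.PosSemidef.of_dotProduct_mulVec_nonneg ?_ fun t => ?_
  · ext i j
    simp only [Matrix.conjTranspose_apply, asympCov, Matrix.of_apply, star_trivial, mul_comm]
  · have := sum_asympCov_eq_asympVar hpos n h h' t
    simp only [dotProduct, Matrix.mulVec, star_trivial]
    rw [this]
    exact Finset.sum_nonneg fun p _ => integral_nonneg fun u => sq_nonneg _

end CoupledModel

/-! ### Estimates for ratios and for products of phases and Gaussian factors. -/

/-- If `B R = A` with `B` close to the constant `b > 0` and `R` bounded, then the second moment of
`R` is controlled by those of `A` and `B - b`. -/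
theorem integral_sq_le_of_mul_eq {Ω : Type*} [MeasurableSpace Ω] (P : Measure Ω)
    [IsProbabilityMeasure P] {A B R : Ω → ℝ} (hA : BddMeas A) (hB : BddMeas B) (hR : BddMeas R)
    {b K : ℝ} (hb : 0 < b) (hK : ∀ ω, |R ω| ≤ K) (h : ∀ ω, B ω * R ω = A ω) :
    ∫ ω, R ω ^ 2 ∂P ≤
      2 / b ^ 2 * ∫ ω, A ω ^ 2 ∂P + 2 * K ^ 2 / b ^ 2 * ∫ ω, (B ω - b) ^ 2 ∂P := by
  have i2 := (hB.sub (BddMeas.const b)).sq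
  rw [← integral_const_mul, ← integral_const_mul,
    ← integral_add ((hA.sq.const_mul _).integrable P) ((i2.const_mul _).integrable P)]
  refine integral_mono (hR.sq.integrable P)
    (((hA.sq.const_mul _).add (i2.const_mul _)).integrable P) fun ω => ?_
  -- Rewriting `B R = A` as `b R = A - (B - b) R` avoids dividing by `B`, which may vanish.
  have h1 : R ω ^ 2 = (A ω - (B ω - b) * R ω) ^ 2 / b ^ 2 := by
    rw [← h ω]
    field_simp
    ring
  have h2 : R ω ^ 2 ≤ K ^ 2 := by
    rw [← sq_abs]
    exact pow_le_pow_left₀ (abs_nonneg _) (hK ω) 2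
  have h3 : (A ω - (B ω - b) * R ω) ^ 2 ≤ 2 * A ω ^ 2 + 2 * ((B ω - b) ^ 2 * R ω ^ 2) := by
    linarith [sq_nonneg (A ω + (B ω - b) * R ω),
      show (A ω - (B ω - b) * R ω) ^ 2 + (A ω + (B ω - b) * R ω) ^ 2 =
        2 * A ω ^ 2 + 2 * ((B ω - b) ^ 2 * R ω ^ 2) by ring]
  have h4 : (B ω - b) ^ 2 * R ω ^ 2 ≤ (B ω - b) ^ 2 * K ^ 2 :=
    mul_le_mul_of_nonneg_left h2 (sq_nonneg _)
  calc R ω ^ 2 = (A ω - (B ω - b) * R ω) ^ 2 / b ^ 2 := h1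
    _ ≤ (2 * A ω ^ 2 + 2 * ((B ω - b) ^ 2 * K ^ 2)) / b ^ 2 := by gcongr; linarith
    _ = _ := by ring

/-- If `B R = A` with `B` close to the constant `b > 0`, then `R` is close to `A / b`. -/
theorem integral_abs_sub_div_le_of_mul_eq {Ω : Type*} [MeasurableSpace Ω] (P : Measure Ω)
    [IsProbabilityMeasure P] {A B R : Ω → ℝ} (hA : BddMeas A) (hB : BddMeas B) (hR : BddMeas R)
    {b : ℝ} (hb : 0 < b) (h : ∀ ω, B ω * R ω = A ω) :
    ∫ ω, |R ω - A ω / b| ∂P ≤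
      1 / b * (∫ ω, R ω ^ 2 ∂P + ∫ ω, (B ω - b) ^ 2 ∂P) := by
  have i2 := (hB.sub (BddMeas.const b)).sq
  rw [← integral_add (hR.sq.integrable P) (i2.integrable P), ← integral_const_mul]
  refine integral_mono ((hR.sub (hA.div_const b)).abs.integrable P)
    (((hR.sq.add i2).const_mul _).integrable P) fun ω => ?_
  -- The linearization error is a product of two small quantities, hence of second order.
  have h1 : R ω - A ω / b = 1 / b * ((b - B ω) * R ω) := by
    rw [← h ω]
    field_simp
  change |R ω - A ω / b| ≤ 1 / b * (R ω ^ 2 + (B ω - b) ^ 2)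
  rw [h1, abs_mul, abs_of_pos (by positivity : 0 < 1 / b)]
  refine mul_le_mul_of_nonneg_left ?_ (by positivity)
  rw [abs_le]
  constructor <;> nlinarith [sq_nonneg (R ω - (B ω - b)), sq_nonneg (R ω + (B ω - b)),
    sq_nonneg (R ω), sq_nonneg (B ω - b)]

/-- Both factors are Lipschitz and bounded by `1`. This converts mean errors of the drift and of the
conditional variance into errors of characteristic functions. -/
theorem norm_exp_mul_exp_sub_le (x y : ℝ) {v w : ℝ} (hv : 0 ≤ v) (hw : 0 ≤ w) :
    ‖Complex.exp (x * Complex.I) * Real.exp (-v / 2) -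
      Complex.exp (y * Complex.I) * Real.exp (-w / 2)‖ ≤ |x - y| + |v - w| := by
  have h1 : ‖Complex.exp (x * Complex.I) - Complex.exp (y * Complex.I)‖ ≤ |x - y| := by
    have h := Real.norm_exp_I_mul_ofReal_sub_one_le (x := x - y)
    have h' : Complex.exp (x * Complex.I) - Complex.exp (y * Complex.I) =
        Complex.exp (y * Complex.I) * (Complex.exp (Complex.I * ((x - y : ℝ) : ℂ)) - 1) := by
      rw [mul_sub, ← Complex.exp_add, mul_one]
      congr 2
      push_cast
      ring
    rw [h', norm_mul, Complex.norm_exp_ofReal_mul_I, one_mul]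
    exact h
  have aux : ∀ {a b : ℝ}, 0 ≤ a → a ≤ b →
      |Real.exp (-a / 2) - Real.exp (-b / 2)| ≤ |a - b| := by
    intro a b ha hab
    have h2 : Real.exp (-b / 2) ≤ Real.exp (-a / 2) := Real.exp_le_exp.2 (by linarith)
    have h3 : Real.exp (-a / 2) ≤ 1 := Real.exp_le_one_iff.2 (by linarith)
    have h4 : Real.exp (-b / 2) = Real.exp (-a / 2) * Real.exp ((a - b) / 2) := by
      rw [← Real.exp_add]
      ring_nf
    have h5 := Real.add_one_le_exp ((a - b) / 2)
    rw [abs_of_nonneg (by linarith), abs_sub_comm, abs_of_nonneg (by linarith : 0 ≤ b - a), h4]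
    have h6 : Real.exp (-a / 2) * (1 - Real.exp ((a - b) / 2)) ≤
        1 * (1 - Real.exp ((a - b) / 2)) :=
      mul_le_mul_of_nonneg_right h3
        (by linarith [Real.exp_le_one_iff.2 (by linarith : (a - b) / 2 ≤ 0)])
    linarith
  have h2 : |Real.exp (-v / 2) - Real.exp (-w / 2)| ≤ |v - w| := by
    rcases le_total v w with hvw | hvw
    · exact aux hv hvw
    · rw [abs_sub_comm, abs_sub_comm v]
      exact aux hw hvw
  have h3 : Complex.exp (x * Complex.I) * Real.exp (-v / 2) -
      Complex.exp (y * Complex.I) * Real.exp (-w / 2) =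
      (Complex.exp (x * Complex.I) - Complex.exp (y * Complex.I)) * Real.exp (-v / 2) +
        Complex.exp (y * Complex.I) * ((Real.exp (-v / 2) - Real.exp (-w / 2) : ℝ) : ℂ) := by
    push_cast
    ring
  rw [h3]
  refine (norm_add_le _ _).trans (add_le_add ?_ ?_)
  · rw [norm_mul, Complex.norm_real, Real.norm_eq_abs, abs_of_pos (Real.exp_pos _)]
    exact (mul_le_of_le_one_right (norm_nonneg _)
      (Real.exp_le_one_iff.2 (by linarith))).trans h1
  · rw [norm_mul, Complex.norm_exp_ofReal_mul_I, one_mul, Complex.norm_real, Real.norm_eq_abs]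
    exact h2

namespace CoupledModel

variable {m : CoupledModel}

/-! ### The particle system -/

/-- The law of the particles at time `n`. -/
noncomputable def particleMarg (m : CoupledModel) (N : ℕ) : ℕ → Measure (Fin N → ℝ × ℝ)
  | 0 => Measure.pi fun _ => m.initc
  | n + 1 => (particleMarg m N n).bind (m.particleKernel N n)

instance isProbabilityMeasure_particleMarg (m : CoupledModel) (N n : ℕ) :
    IsProbabilityMeasure (m.particleMarg N n) := by
  induction n with
  | zero => exact inferInstanceAs (IsProbabilityMeasure (Measure.pi fun _ => m.initc))
  | succ n ih =>
    rw [particleMarg]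
    infer_instance

/-- The transition at time `n` depends on the past only through its last coordinate, so the one-time
laws of the trajectory measure follow the Markov recursion. All later estimates involve a single
time or two consecutive times and can forget the trajectory. -/
theorem map_systemLaw (m : CoupledModel) (N n : ℕ) :
    (m.systemLaw N).map (fun u => u n) = m.particleMarg N n := by
  induction n with
  | zero =>
    have h : (fun u : ℕ → Fin N → ℝ × ℝ => u 0) =
        (fun v : (i : Finset.Iic 0) → Fin N → ℝ × ℝ => v ⟨0, Finset.mem_Iic.2 le_rfl⟩) ∘
          Preorder.frestrictLe (π := fun _ => Fin N → ℝ × ℝ) 0 := rfl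
    rw [h, ← Measure.map_map (by fun_prop) (by fun_prop), systemLaw, Kernel.trajMeasure,
      Measure.map_comp _ _ (by fun_prop), Kernel.traj_map_frestrictLe, Kernel.partialTraj_self,
      Measure.id_comp, Measure.map_map (by fun_prop) (by fun_prop), particleMarg]
    exact Measure.map_id
  | succ n ih =>
    have h := Kernel.map_frestrictLe_trajMeasure_compProd_eq_map_trajMeasure
      (X := fun _ => Fin N → ℝ × ℝ) (μ₀ := Measure.pi fun _ : Fin N => m.initc)
      (κ := fun n => (m.particleKernel N n).comap
        (fun h : (i : Finset.Iic n) → Fin N → ℝ × ℝ => h ⟨n, Finset.mem_Iic.2 le_rfl⟩)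
        (measurable_pi_apply _)) (a := n)
    have h' := congrArg Measure.snd h
    rw [Measure.snd_compProd, Measure.snd, Measure.map_map (by fun_prop) (by fun_prop)] at h'
    refine Eq.trans h'.symm ?_
    rw [particleMarg, ← ih]
    have h2 : (fun u : ℕ → Fin N → ℝ × ℝ => u n) =
        (fun v : (i : Finset.Iic n) → Fin N → ℝ × ℝ => v ⟨n, Finset.mem_Iic.2 le_rfl⟩) ∘
          Preorder.frestrictLe (π := fun _ => Fin N → ℝ × ℝ) n := rfl
    rw [h2, ← Measure.map_map (by fun_prop) (by fun_prop),
      ← Measure.deterministic_comp_eq_map (measurable_pi_apply _), Measure.comp_assoc,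
      Kernel.comp_deterministic_eq_comap]
    rfl

theorem G_eq_zero_of_sum_eq_zero (m : CoupledModel) (n : ℕ) {N : ℕ} {x : Fin N → ℝ}
    (h : ∑ i, m.G n (x i) = 0) (i : Fin N) : m.G n (x i) = 0 :=
  (Finset.sum_eq_zero_iff_of_nonneg fun _ _ => m.G_nonneg n _).1 h i (Finset.mem_univ i)

/-- The form without division holds on every sample: if the total weight vanishes, so does each
weight, and both sides are zero. -/
theorem sum_G_mul_integral_etaBarN (m : CoupledModel) (n : ℕ) {N : ℕ} (x : Fin N → ℝ)
    {φ : ℝ → ℝ} (h : BddMeas φ) :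
    (∑ i, m.G n (x i)) * ∫ y, φ y ∂m.etaBarN n x = ∑ i, m.G n (x i) * φ (x i) := by
  have hS : 0 ≤ ∑ i, m.G n (x i) := Finset.sum_nonneg fun i _ => m.G_nonneg n _
  rw [etaBarN, integral_finsetSum_measure fun i _ =>
    (h.integrable (Measure.dirac (x i))).smul_measure ENNReal.ofReal_ne_top, Finset.mul_sum]
  refine Finset.sum_congr rfl fun i _ => ?_
  rw [integral_smul_measure, integral_dirac' _ _ h.measurable.stronglyMeasurable,
    ENNReal.toReal_ofReal (div_nonneg (m.G_nonneg n _) hS), smul_eq_mul, ← mul_assoc]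
  congr 1
  rcases hS.eq_or_lt with h0 | h0
  · rw [← h0, zero_mul]
    exact (m.G_eq_zero_of_sum_eq_zero n h0.symm i).symm
  · field_simp

theorem isProbabilityMeasure_etaBarN (m : CoupledModel) (n : ℕ) {N : ℕ} (x : Fin N → ℝ)
    (h : ∑ i, m.G n (x i) ≠ 0) : IsProbabilityMeasure (m.etaBarN n x) := by
  refine ⟨?_⟩
  have hS : 0 ≤ ∑ i, m.G n (x i) := Finset.sum_nonneg fun i _ => m.G_nonneg n _
  simp only [etaBarN, Measure.finsetSum_apply, Measure.smul_apply, measure_univ, smul_eq_mul,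
    mul_one]
  rw [← ENNReal.ofReal_sum_of_nonneg fun i _ => div_nonneg (m.G_nonneg n _) hS,
    ← Finset.sum_div, div_self h, ENNReal.ofReal_one]

theorem mean_G_mul_cdf_etaBarN_sub (m : CoupledModel) (s : Level) (n : ℕ) {N : ℕ}
    (u : Fin N → ℝ × ℝ) (t c : ℝ) :
    mean (fun z => m.G n (proj s z)) u * (cdf (m.etaBarN n fun i => proj s (u i)) t - c) =
      mean (fun z => m.G n (proj s z) *
        ((Set.Iic t).indicator (fun _ => (1 : ℝ)) (proj s z) - c)) u := by
  simp only [mean]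
  by_cases h : ∑ i, m.G n (proj s (u i)) = 0
  -- The value of `cdf` at the degenerate measure is irrelevant here, since it is multiplied by
  -- zero.
  · simp [fun i => m.G_eq_zero_of_sum_eq_zero n (x := fun i => proj s (u i)) h i]
  · have := m.isProbabilityMeasure_etaBarN n (fun i => proj s (u i)) h
    have hind : BddMeas ((Set.Iic t).indicator fun _ => (1 : ℝ)) :=
      ⟨measurable_const.indicator measurableSet_Iic, 1, fun x => by
        by_cases hx : x ∈ Set.Iic t <;> simp [hx]⟩
    have h1 := m.sum_G_mul_integral_etaBarN n (fun i => proj s (u i)) hind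
    rw [integral_indicator_const _ measurableSet_Iic, smul_eq_mul, mul_one] at h1
    rw [cdf_eq_real, mul_assoc, mul_sub, h1]
    simp only [mul_sub, Finset.sum_sub_distrib, Finset.sum_mul]

/-- The error of the conditional law of the particles on a function of one coordinate. -/
noncomputable def drift (m : CoupledModel) (s : Level) (n : ℕ) {N : ℕ} (φ : ℝ → ℝ)
    (u : Fin N → ℝ × ℝ) : ℝ :=
  ∫ z, φ (proj s z) ∂m.particleLaw n u - ∫ x, φ x ∂m.eta s (n + 1)

/-- Exhibits the drift as a self-normalized mean, in the shape `B R = A` required by the ratio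
estimates; the degenerate event contributes `0 = 0`. -/
theorem mean_G_mul_drift (m : CoupledModel) (s : Level) (n : ℕ) {N : ℕ} {φ : ℝ → ℝ}
    (h : BddMeas φ) (u : Fin N → ℝ × ℝ) :
    mean (fun z => m.G n (proj s z)) u * m.drift s n φ u =
      mean (fun z => m.G n (proj s z) *
        ∫ y, (φ y - ∫ x, φ x ∂m.eta s (n + 1)) ∂m.M s (n + 1) (proj s z)) u := by
  simp only [mean]
  by_cases h0 : ∑ i, m.G n (proj s (u i)) = 0
  · simp [fun i => m.G_eq_zero_of_sum_eq_zero n (x := fun i => proj s (u i)) h0 i]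
  · have := m.isProbabilityMeasure_etaBarN n (fun i => proj s (u i)) h0
    have h1 := m.sum_G_mul_integral_etaBarN n (fun i => proj s (u i))
      (h.integral_kernel (m.M s (n + 1)))
    rw [← m.integral_proj_PhiW s (n + 1) n.succ_pos
      (fun s => m.etaBarN n fun i => proj s (u i)) h] at h1
    change (∑ i, m.G n (proj s (u i))) * ∫ z, φ (proj s z) ∂m.particleLaw n u = _ at h1
    have h2 : ∀ x, ∫ y, (φ y - ∫ x, φ x ∂m.eta s (n + 1)) ∂m.M s (n + 1) x =
        ∫ y, φ y ∂m.M s (n + 1) x - ∫ x, φ x ∂m.eta s (n + 1) := fun x => by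
      rw [integral_sub (h.integrable _) (integrable_const _)]
      simp
    rw [drift, mul_assoc, mul_sub, h1]
    simp only [h2, mul_sub, Finset.sum_sub_distrib, Finset.sum_mul]

theorem bddMeas_integral_particleLaw (m : CoupledModel) (n N : ℕ) {h : ℝ × ℝ → ℝ}
    (hh : BddMeas h) : BddMeas fun u : Fin N → ℝ × ℝ => ∫ z, h z ∂m.particleLaw n u := by
  let κ : Kernel (Fin N → ℝ × ℝ) (ℝ × ℝ) :=
    ⟨fun u => m.particleLaw n u, m.measurable_particleLaw n N⟩
  have : IsMarkovKernel κ := ⟨fun u => inferInstanceAs (IsProbabilityMeasure (m.particleLaw n u))⟩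
  exact hh.integral_kernel κ

theorem bddMeas_drift (m : CoupledModel) (s : Level) (n N : ℕ) {φ : ℝ → ℝ} (h : BddMeas φ) :
    BddMeas fun u : Fin N → ℝ × ℝ => m.drift s n φ u :=
  (m.bddMeas_integral_particleLaw n N (h.comp (measurable_proj s))).sub (BddMeas.const _)

theorem integral_particleMarg_succ (m : CoupledModel) (N n : ℕ) {V : Type*}
    [NormedAddCommGroup V] [NormedSpace ℝ V] {F : (Fin N → ℝ × ℝ) → V}
    (hF : Integrable F (m.particleMarg N (n + 1))) :
    ∫ u, F u ∂m.particleMarg N (n + 1) =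
      ∫ u, ∫ v, F v ∂(Measure.pi fun _ => m.particleLaw n u) ∂m.particleMarg N n := by
  rw [particleMarg] at hF ⊢
  exact integral_bind_kernel hF

/-! ### Mean square convergence -/

/-- The empirical measures of one level at time `n` converge on `φ` in mean square at rate
`1 / N`. -/
def MeanSqRate (m : CoupledModel) (s : Level) (n : ℕ) (φ : ℝ → ℝ) : Prop :=
  ∃ C, 0 ≤ C ∧ ∀ N : ℕ, 1 ≤ N → ∫ u, (mean (fun z => φ (proj s z)) u - ∫ x, φ x ∂m.eta s n) ^ 2
    ∂m.particleMarg N n ≤ C / N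

/-- A bounded quantity `R` with `η_n^N(G_n) R = η_n^N(φ)`, where `η_n(φ) = 0`, has mean square of
order `1 / N`. -/
theorem exists_integral_sq_le_of_mean_G_mul_eq
    (hpos : ∀ (s : Level) (n : ℕ), 0 < ∫ x, m.G n x ∂m.eta s n) {s : Level} {n : ℕ} {φ : ℝ → ℝ}
    (hφ : BddMeas φ) (h0 : ∫ x, φ x ∂m.eta s n = 0) (hr : m.MeanSqRate s n φ)
    (hrG : m.MeanSqRate s n (m.G n)) {K : ℝ} (R : ∀ N : ℕ, (Fin N → ℝ × ℝ) → ℝ)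
    (hR : ∀ N, BddMeas (R N)) (hK : ∀ N u, |R N u| ≤ K)
    (h : ∀ N u, mean (fun z => m.G n (proj s z)) u * R N u = mean (fun z => φ (proj s z)) u) :
    ∃ C, 0 ≤ C ∧ ∀ N : ℕ, 1 ≤ N → ∫ u, R N u ^ 2 ∂m.particleMarg N n ≤ C / N := by
  obtain ⟨C, hC0, hC⟩ := hr
  obtain ⟨C', hC0', hC'⟩ := hrG
  set b := ∫ x, m.G n x ∂m.eta s n
  have hb : 0 < b := hpos s n
  refine ⟨2 / b ^ 2 * C + 2 * K ^ 2 / b ^ 2 * C', by positivity, fun N hN => ?_⟩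
  have h1 := integral_sq_le_of_mul_eq (m.particleMarg N n)
    ((hφ.comp (measurable_proj s)).mean N) (((m.bddMeas_G n).comp (measurable_proj s)).mean N)
    (hR N) hb (hK N) (h N)
  have h2 := hC N hN
  rw [h0] at h2
  simp only [sub_zero] at h2
  refine h1.trans ?_
  rw [add_div, mul_div_assoc _ C, mul_div_assoc _ C']
  have h3 := hC' N hN
  gcongr

section Positive

variable (hpos : ∀ (s : Level) (n : ℕ), 0 < ∫ x, m.G n x ∂m.eta s n)
include hpos

theorem abs_drift_le {s : Level} {n N : ℕ} {φ : ℝ → ℝ} {K : ℝ} (hK : ∀ x, |φ x| ≤ K)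
    (u : Fin N → ℝ × ℝ) : |m.drift s n φ u| ≤ 2 * K := by
  have := isProbabilityMeasure_eta hpos s (n + 1)
  exact (abs_sub _ _).trans ((add_le_add (abs_integral_le_of_bound (fun z => hK _) _)
    (abs_integral_le_of_bound hK _)).trans_eq (two_mul K).symm)

/-- The numerator of the drift is the empirical mean of a function centred under `η_n`, so the rate
at time `n` applies to it and to the denominator. -/
theorem exists_integral_sq_drift_le (s : Level) (n : ℕ)
    (hr : ∀ φ, BddMeas φ → m.MeanSqRate s n φ) {φ : ℝ → ℝ} (hφ : BddMeas φ) :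
    ∃ C, 0 ≤ C ∧ ∀ N : ℕ, 1 ≤ N → ∫ u, m.drift s n φ u ^ 2 ∂m.particleMarg N n ≤ C / N := by
  obtain ⟨K, hK⟩ := hφ.bounded
  have hA := m.bddMeas_G_mul_integral
    (hφ.sub (BddMeas.const (∫ x, φ x ∂m.eta s (n + 1)))) s n (n + 1)
  exact exists_integral_sq_le_of_mean_G_mul_eq hpos hA
    (integral_G_mul_integral_centred hpos s n hφ) (hr _ hA) (hr _ (m.bddMeas_G n))
    (fun N u => m.drift s n φ u) (fun N => m.bddMeas_drift s n N hφ)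
    (fun N u => abs_drift_le hpos hK u) fun N u => m.mean_G_mul_drift s n hφ u

/-- Conditionally on time `n`, the mean square error at time `n + 1` is at most `K ^ 2 / N` plus the
squared drift, and the drift is controlled by the rate at time `n` for other functions; hence the
induction over all `φ` at once. -/
theorem meanSqRate (s : Level) (n : ℕ) : ∀ φ, BddMeas φ → m.MeanSqRate s n φ := by
  induction n with
  | zero =>
    intro φ hφ
    obtain ⟨K, hK⟩ := hφ.bounded
    refine ⟨K ^ 2, sq_nonneg K, fun N hN => ?_⟩
    have h := integral_sq_mean_sub_le m.initc (g := fun z => φ (proj s z)) (K := K)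
      (hφ.comp (measurable_proj s)).measurable (fun z => hK _) (∫ x, φ x ∂m.eta s 0) hN
    have h' := integral_proj_etaW hpos s 0 hφ
    rw [etaW] at h'
    rw [h', sub_self] at h
    simpa [particleMarg] using h
  | succ n ih =>
    intro φ hφ
    obtain ⟨K, hK⟩ := hφ.bounded
    obtain ⟨C, hC0, hC⟩ := exists_integral_sq_drift_le hpos s n ih hφ
    refine ⟨K ^ 2 + C, by positivity, fun N hN => ?_⟩
    have hm := (((hφ.comp (measurable_proj s)).mean N).sub
      (BddMeas.const (∫ x, φ x ∂m.eta s (n + 1)))).sq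
    rw [m.integral_particleMarg_succ N n (hm.integrable _)]
    have hd := (m.bddMeas_drift s n N hφ).sq
    have hle : ∫ u, ∫ v, (mean (fun z => φ (proj s z)) v - ∫ x, φ x ∂m.eta s (n + 1)) ^ 2
        ∂(Measure.pi fun _ : Fin N => m.particleLaw n u) ∂m.particleMarg N n ≤
        ∫ u, (K ^ 2 / N + m.drift s n φ u ^ 2) ∂m.particleMarg N n := by
      refine integral_mono ((hm.integral_kernel (m.particleKernel N n)).integrable _)
        (((BddMeas.const _).add hd).integrable _) fun u => ?_
      exact integral_sq_mean_sub_le (m.particleLaw n u)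
        (hφ.comp (measurable_proj s)).measurable (fun z => hK _) _ hN
    rw [integral_add (integrable_const _) (hd.integrable _)] at hle
    simp only [integral_const, probReal_univ, one_smul] at hle
    rw [add_div]
    linarith [hC N hN]

/-- The drift is linear in the empirical measure up to an error of order `1 / N`. -/
theorem exists_integral_abs_drift_sub_le (s : Level) (n : ℕ) {φ : ℝ → ℝ} (hφ : BddMeas φ) :
    ∃ C, 0 ≤ C ∧ ∀ N : ℕ, 1 ≤ N →
      ∫ u, |m.drift s n φ u - mean (fun z => m.pull s n φ (proj s z)) u| ∂m.particleMarg N n ≤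
        C / N := by
  obtain ⟨C, hC0, hC⟩ := exists_integral_sq_drift_le hpos s n (meanSqRate hpos s n) hφ
  obtain ⟨C', hC0', hC'⟩ := meanSqRate hpos s n _ (m.bddMeas_G n)
  have hb := hpos s n
  refine ⟨1 / (∫ x, m.G n x ∂m.eta s n) * (C + C'), by positivity, fun N hN => ?_⟩
  have hA := (m.bddMeas_G_mul_integral
    (hφ.sub (BddMeas.const (∫ x, φ x ∂m.eta s (n + 1)))) s n (n + 1)).comp (measurable_proj s)
  have h1 := integral_abs_sub_div_le_of_mul_eq (m.particleMarg N n) (hA.mean N)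
    (((m.bddMeas_G n).comp (measurable_proj s)).mean N) (m.bddMeas_drift s n N hφ) hb
    (m.mean_G_mul_drift s n hφ)
  simp only [pull, mean_div]
  refine h1.trans ?_
  rw [mul_div_assoc, add_div]
  have h2 := hC N hN
  have h3 := hC' N hN
  gcongr

/-- Again a ratio, with numerator the mean of `G_n (1_{Iic t} - c)`. The indicator is discontinuous,
which is why `meanSqRate` is stated for bounded measurable functions. -/
theorem tendsto_integral_sq_cdf_sub (s : Level) (n : ℕ) (t : ℝ) :
    Tendsto (fun N : ℕ => ∫ u, (cdf (m.etaBarN n fun i : Fin N => proj s (u i)) t -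
      cdf (m.etaBar s n) t) ^ 2 ∂m.particleMarg N n) atTop (𝓝 0) := by
  have := isProbabilityMeasure_etaBar hpos s n
  have := isProbabilityMeasure_eta hpos s n
  set c := cdf (m.etaBar s n) t with hc
  have hind : BddMeas ((Set.Iic t).indicator fun _ => (1 : ℝ)) :=
    ⟨measurable_const.indicator measurableSet_Iic, 1, fun x => by
      by_cases hx : x ∈ Set.Iic t <;> simp [hx]⟩
  have hA : BddMeas fun x => m.G n x * ((Set.Iic t).indicator (fun _ => (1 : ℝ)) x - c) :=
    (m.bddMeas_G n).mul (hind.sub (BddMeas.const c))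
  have hA0 : ∫ x, m.G n x * ((Set.Iic t).indicator (fun _ => (1 : ℝ)) x - c) ∂m.eta s n = 0 := by
    rw [← integral_etaBar_mul hpos, integral_sub (hind.integrable _) (integrable_const _),
      integral_indicator_const _ measurableSet_Iic, hc, cdf_eq_real]
    simp
  -- Valid for every measure, so the event of vanishing weights is included.
  have h01 : ∀ (μ : Measure ℝ), |cdf μ t - c| ≤ 1 := fun μ => by
    have h1 := cdf_nonneg μ t
    have h2 := cdf_le_one μ t
    have h3 := cdf_nonneg (m.etaBar s n) t
    have h4 := cdf_le_one (m.etaBar s n) t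
    rw [abs_le]
    constructor <;> linarith
  obtain ⟨C, hC0, hC⟩ := exists_integral_sq_le_of_mean_G_mul_eq hpos hA hA0
    (meanSqRate hpos s n _ hA) (meanSqRate hpos s n _ (m.bddMeas_G n))
    (fun N u => cdf (m.etaBarN n fun i : Fin N => proj s (u i)) t - c)
    (fun N => ⟨((m.measurable_cdf_etaBarN n N t).comp (measurable_pi_lambda _ fun i =>
      (measurable_proj s).comp (measurable_pi_apply i))).sub measurable_const, 1,
      fun u => h01 _⟩)
    (fun N u => h01 _) fun N u => m.mean_G_mul_cdf_etaBarN_sub s n u t c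
  exact squeeze_zero' (.of_forall fun N => integral_nonneg fun u => sq_nonneg _)
    ((eventually_ge_atTop 1).mono hC) (tendsto_const_div_atTop_nhds_zero_nat C)

/-- The conditional laws of the particles converge weakly, in the mean, to the limiting
coupling. -/
theorem tendsto_integral_abs_particleLaw_sub
    (hinv : ∀ (s : Level) (n : ℕ), ContinuousOn (quantile (m.etaBar s n)) (Set.Ioo (0 : ℝ) 1))
    (n : ℕ) (hMc : IsFeller (m.Mc (n + 1))) {h : ℝ × ℝ → ℝ} (hh : Continuous h)
    (hb : ∃ K, ∀ z, |h z| ≤ K) :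
    Tendsto (fun N : ℕ => ∫ u : Fin N → ℝ × ℝ, |∫ z, h z ∂m.particleLaw n u -
      ∫ z, h z ∂m.etaW (n + 1)| ∂m.particleMarg N n) atTop (𝓝 0) := by
  obtain ⟨K, hK⟩ := hb
  have hhb : BddMeas h := BddMeas.of_continuous hh ⟨K, hK⟩
  -- The Feller property moves the test function from after the mutation to the resampled pair,
  -- where the Wasserstein coupling lives.
  have hcont : Continuous fun u => ∫ z, h z ∂m.Mc (n + 1) u :=
    hMc (BoundedContinuousFunction.ofNormedAddCommGroup h hh K hK)
  have hmeas : ∀ (s : Level) (N : ℕ) (t : ℝ), Measurable fun u : Fin N → ℝ × ℝ =>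
      cdf (m.etaBarN n fun i => proj s (u i)) t := fun s N t =>
    (m.measurable_cdf_etaBarN n N t).comp (measurable_pi_lambda _ fun i =>
      (measurable_proj s).comp (measurable_pi_apply i))
  have := tendsto_integral_abs_wassersteinCoupling_sub (fun N => m.particleMarg N n)
    (fun N u => m.etaBarN n fun i => proj Level.f (u i))
    (fun N u => m.etaBarN n fun i => proj Level.c (u i)) _ _ (hmeas Level.f) (hmeas Level.c)
    (hinv Level.f n) (hinv Level.c n) (tendsto_integral_sq_cdf_sub hpos Level.f n)
    (tendsto_integral_sq_cdf_sub hpos Level.c n) hcont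
    (fun u => abs_integral_le_of_bound hK _)
  refine this.congr fun N => ?_
  simp only [etaW, particleLaw, m.integral_PhiW _ _ _ hhb]
  rfl

end Positive

/-! ### The central limit theorem -/

/-- The empirical characteristic function of the scaled error at time `n`. -/
noncomputable def charError (m : CoupledModel) (n N : ℕ) (φ ψ : ℝ → ℝ) : ℂ :=
  ∫ u, Complex.exp ((√(N : ℝ) * (mean (fun z => φ z.1 - ψ z.2) u -
    ∫ z, (φ z.1 - ψ z.2) ∂m.etaW n) : ℝ) * Complex.I) ∂m.particleMarg N n

theorem integrable_exp_mul_I {Ω : Type*} [MeasurableSpace Ω] (P : Measure Ω) [IsFiniteMeasure P]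
    {X : Ω → ℝ} (hX : Measurable X) : Integrable (fun ω => Complex.exp (X ω * Complex.I)) P :=
  Integrable.of_bound (by fun_prop : Measurable fun ω =>
    Complex.exp (X ω * Complex.I)).aestronglyMeasurable 1
    (.of_forall fun ω => by rw [Complex.norm_exp_ofReal_mul_I])

theorem integrable_integral_exp_mul_I {Ω Ω' : Type*} [MeasurableSpace Ω] [MeasurableSpace Ω']
    (P : Measure Ω) [IsFiniteMeasure P] (κ : Kernel Ω Ω') [IsMarkovKernel κ] {X : Ω' → ℝ}
    (hX : Measurable X) : Integrable (fun ω => ∫ v, Complex.exp (X v * Complex.I) ∂κ ω) P := by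
  have hm : Measurable fun v => Complex.exp (X v * Complex.I) := by fun_prop
  refine Integrable.of_bound
    (hm.stronglyMeasurable.integral_kernel (κ := κ)).aestronglyMeasurable 1 (.of_forall fun ω => ?_)
  exact (norm_integral_le_of_norm_le_const (C := 1)
    (.of_forall fun v => by rw [Complex.norm_exp_ofReal_mul_I])).trans (by simp)

theorem tendsto_const_mul_inv_sqrt (C : ℝ) :
    Tendsto (fun N : ℕ => C * (√(N : ℝ))⁻¹) atTop (𝓝 0) := by
  have h := (tendsto_inv_atTop_zero.comp
    (Real.tendsto_sqrt_atTop.comp (tendsto_natCast_atTop_atTop (R := ℝ)))).const_mul C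
  rw [mul_zero] at h
  exact h

theorem tendsto_charError_zero (hpos : ∀ (s : Level) (n : ℕ), 0 < ∫ x, m.G n x ∂m.eta s n)
    {φ ψ : ℝ → ℝ} (h : BddMeas φ) (h' : BddMeas ψ) :
    Tendsto (fun N => m.charError 0 N φ ψ) atTop
      (𝓝 ((Real.exp (-(m.asympVar 0 φ ψ) / 2) : ℝ) : ℂ)) := by
  have hf := bddMeas_diff h h'
  obtain ⟨K, hK⟩ := hf.bounded
  rw [tendsto_iff_norm_sub_tendsto_zero, asympVar_zero hpos h h']
  refine squeeze_zero' (.of_forall fun _ => norm_nonneg _)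
    ((eventually_ge_atTop 1).mono fun N hN => ?_) (tendsto_const_mul_inv_sqrt
      ((2 * K) ^ 3 * Real.exp (2 * K) + (2 * K) ^ 4 * Real.exp ((2 * K) ^ 2)))
  have h1 := norm_integral_exp_mean_sub_le (m.etaW 0) hf.measurable hK
    (∫ z, (φ z.1 - ψ z.2) ∂m.etaW 0) hN
  -- At time `0` the particles are i.i.d. from the limit itself, so there is no drift.
  simp only [sub_self, mul_zero, Complex.ofReal_zero, zero_mul, Complex.exp_zero, one_mul] at h1
  exact h1

theorem integral_sq_sub_sq_nonneg {E : Type*} [MeasurableSpace E] (μ : Measure E)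
    [IsProbabilityMeasure μ] {f : E → ℝ} (hf : BddMeas f) :
    0 ≤ ∫ x, f x ^ 2 ∂μ - (∫ x, f x ∂μ) ^ 2 := by
  have h := variance_nonneg f μ
  rw [variance_eq_sub (hf.memLp μ 2)] at h
  exact h

section Positive

variable (hpos : ∀ (s : Level) (n : ℕ), 0 < ∫ x, m.G n x ∂m.eta s n)
include hpos

/-- The scaled error at time `n + 1` is asymptotically the scaled error at time `n` of the pulled
back functions plus an independent Gaussian variable. -/
theorem tendsto_charError_succ_sub
    (hinv : ∀ (s : Level) (n : ℕ), ContinuousOn (quantile (m.etaBar s n)) (Set.Ioo (0 : ℝ) 1))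
    (n : ℕ) (hMc : IsFeller (m.Mc (n + 1))) {φ ψ : ℝ → ℝ} (hφ : Continuous φ) (hψ : Continuous ψ)
    (hφb : ∃ K, ∀ x, |φ x| ≤ K) (hψb : ∃ K, ∀ x, |ψ x| ≤ K) :
    Tendsto (fun N => m.charError (n + 1) N φ ψ -
      m.charError n N (m.pull Level.f n φ) (m.pull Level.c n ψ) *
        Real.exp (-(∫ z, (φ z.1 - ψ z.2) ^ 2 ∂m.etaW (n + 1) -
          (∫ z, (φ z.1 - ψ z.2) ∂m.etaW (n + 1)) ^ 2) / 2)) atTop (𝓝 0) := by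
  have hφ' : BddMeas φ := BddMeas.of_continuous hφ hφb
  have hψ' : BddMeas ψ := BddMeas.of_continuous hψ hψb
  have hf := bddMeas_diff hφ' hψ'
  have hfc : Continuous fun z : ℝ × ℝ => φ z.1 - ψ z.2 := by fun_prop
  have hg := bddMeas_diff (m.bddMeas_pull Level.f n hφ') (m.bddMeas_pull Level.c n hψ')
  set f : ℝ × ℝ → ℝ := fun z => φ z.1 - ψ z.2 with hfdef
  set g : ℝ × ℝ → ℝ := fun z => m.pull Level.f n φ z.1 - m.pull Level.c n ψ z.2 with hgdef
  -- Hence the error of `g` at time `n` is its empirical mean itself; the terms `mean g u - 0` below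
  -- keep the shape of `charError`.
  have hg0 : ∫ z, g z ∂m.etaW n = 0 := by
    rw [hgdef, integral_diff_etaW hpos n (m.bddMeas_pull Level.f n hφ')
      (m.bddMeas_pull Level.c n hψ'), integral_pull hpos _ n hφ', integral_pull hpos _ n hψ',
      sub_zero]
  obtain ⟨K, hK⟩ := hf.bounded
  set a := ∫ z, f z ∂m.etaW (n + 1) with ha
  set a₂ := ∫ z, f z ^ 2 ∂m.etaW (n + 1) with ha₂
  set C := (2 * K) ^ 3 * Real.exp (2 * K) + (2 * K) ^ 4 * Real.exp ((2 * K) ^ 2) with hC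
  obtain ⟨C₁, hC₁0, hC₁⟩ := exists_integral_abs_drift_sub_le hpos Level.f n hφ'
  obtain ⟨C₂, hC₂0, hC₂⟩ := exists_integral_abs_drift_sub_le hpos Level.c n hψ'
  have hlim1 := tendsto_integral_abs_particleLaw_sub hpos hinv n hMc hfc hf.bounded
  have hlim2 := tendsto_integral_abs_particleLaw_sub hpos hinv n hMc
    (h := fun z => f z ^ 2) (hfc.pow 2) hf.sq.bounded
  have hlim := ((tendsto_const_mul_inv_sqrt (C + (C₁ + C₂))).add
    (hlim2.add (hlim1.const_mul (2 * K))))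
  simp only [mul_zero, add_zero] at hlim
  refine squeeze_zero_norm' ((eventually_ge_atTop 1).mono fun N hN => ?_) hlim
  have hN0 : (0 : ℝ) < N := by exact_mod_cast hN
  have hs0 : 0 < √(N : ℝ) := Real.sqrt_pos.2 hN0
  set P := m.particleMarg N n with hP
  set σ := a₂ - a ^ 2 with hσ
  have hσ0 : 0 ≤ σ := integral_sq_sub_sq_nonneg _ hf
  have hmX : Measurable fun v : Fin N → ℝ × ℝ => √(N : ℝ) * (mean f v - a) :=
    (((hf.mean N).sub (BddMeas.const a)).const_mul _).measurable
  have hmY : Measurable fun u : Fin N → ℝ × ℝ => √(N : ℝ) * (mean g u - 0) :=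
    (((hg.mean N).sub (BddMeas.const 0)).const_mul _).measurable
  have hX := integrable_exp_mul_I (m.particleMarg N (n + 1)) hmX
  have hY := integrable_exp_mul_I P hmY
  have hXin : Integrable (fun u => ∫ v, Complex.exp ((√(N : ℝ) * (mean f v - a) : ℝ) * Complex.I)
      ∂(Measure.pi fun _ : Fin N => m.particleLaw n u)) P :=
    integrable_integral_exp_mul_I P (m.particleKernel N n) hmX
  have hd1 : BddMeas fun u : Fin N → ℝ × ℝ =>
      m.drift Level.f n φ u - mean (fun z => m.pull Level.f n φ (proj Level.f z)) u :=
    (m.bddMeas_drift Level.f n N hφ').sub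
      (((m.bddMeas_pull Level.f n hφ').comp (measurable_proj Level.f)).mean N)
  have hd2 : BddMeas fun u : Fin N → ℝ × ℝ =>
      m.drift Level.c n ψ u - mean (fun z => m.pull Level.c n ψ (proj Level.c z)) u :=
    (m.bddMeas_drift Level.c n N hψ').sub
      (((m.bddMeas_pull Level.c n hψ').comp (measurable_proj Level.c)).mean N)
  have hl1 : BddMeas fun u : Fin N → ℝ × ℝ => ∫ z, f z ∂m.particleLaw n u - a :=
    (m.bddMeas_integral_particleLaw n N hf).sub (BddMeas.const _)
  have hl2 : BddMeas fun u : Fin N → ℝ × ℝ => ∫ z, f z ^ 2 ∂m.particleLaw n u - a₂ :=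
    (m.bddMeas_integral_particleLaw n N hf.sq).sub (BddMeas.const _)
  -- Three errors for fixed particles at time `n`: the conditional central limit error, the
  -- linearization of the two drifts, and the fluctuation of the conditional variance.
  have hpt : ∀ u : Fin N → ℝ × ℝ,
      ‖∫ v, Complex.exp ((√(N : ℝ) * (mean f v - a) : ℝ) * Complex.I)
          ∂(Measure.pi fun _ : Fin N => m.particleLaw n u) -
        Complex.exp ((√(N : ℝ) * (mean g u - 0) : ℝ) * Complex.I) * Real.exp (-σ / 2)‖ ≤
      C * (√(N : ℝ))⁻¹ +
        (√(N : ℝ) * (|m.drift Level.f n φ u -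
            mean (fun z => m.pull Level.f n φ (proj Level.f z)) u| +
          |m.drift Level.c n ψ u - mean (fun z => m.pull Level.c n ψ (proj Level.c z)) u|) +
        (|∫ z, f z ^ 2 ∂m.particleLaw n u - a₂| +
          2 * K * |∫ z, f z ∂m.particleLaw n u - a|)) := by
    intro u
    set b := ∫ z, f z ∂m.particleLaw n u with hb
    set b₂ := ∫ z, f z ^ 2 ∂m.particleLaw n u with hb₂
    have h1 := norm_integral_exp_mean_sub_le (m.particleLaw n u) hf.measurable hK a hN
    rw [← hb, ← hb₂, ← hC] at h1
    have h2 := norm_exp_mul_exp_sub_le (√(N : ℝ) * (b - a)) (√(N : ℝ) * (mean g u - 0))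
      (integral_sq_sub_sq_nonneg (m.particleLaw n u) hf) hσ0
    rw [← hb, ← hb₂] at h2
    have h3 : b - a - (mean g u - 0) =
        (m.drift Level.f n φ u - mean (fun z => m.pull Level.f n φ (proj Level.f z)) u) -
        (m.drift Level.c n ψ u - mean (fun z => m.pull Level.c n ψ (proj Level.c z)) u) := by
      have hb' : b = ∫ z, φ (proj Level.f z) ∂m.particleLaw n u -
          ∫ z, ψ (proj Level.c z) ∂m.particleLaw n u := by
        rw [hb, ← integral_sub ((hφ'.comp (measurable_proj Level.f)).integrable _)
          ((hψ'.comp (measurable_proj Level.c)).integrable _)]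
        rfl
      have hg' : mean g u = mean (fun z => m.pull Level.f n φ (proj Level.f z)) u -
          mean (fun z => m.pull Level.c n ψ (proj Level.c z)) u := by
        rw [← mean_sub]
        rfl
      rw [hb', hg', ha, hfdef, integral_diff_etaW hpos (n + 1) hφ' hψ', drift, drift]
      ring
    have h4 : |√(N : ℝ) * (b - a) - √(N : ℝ) * (mean g u - 0)| ≤
        √(N : ℝ) * (|m.drift Level.f n φ u -
            mean (fun z => m.pull Level.f n φ (proj Level.f z)) u| +
          |m.drift Level.c n ψ u - mean (fun z => m.pull Level.c n ψ (proj Level.c z)) u|) := by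
      rw [← mul_sub, h3, abs_mul, abs_of_pos hs0]
      exact mul_le_mul_of_nonneg_left (abs_sub _ _) hs0.le
    -- The conditional variance depends on the first two moments of `f`, so weak convergence of
    -- `particleLaw` tested on `f` and `f ^ 2` is enough.
    have h5 : |b₂ - b ^ 2 - σ| ≤ |b₂ - a₂| + 2 * K * |b - a| := by
      have e : b₂ - b ^ 2 - σ = (b₂ - a₂) - (b + a) * (b - a) := by rw [hσ]; ring
      rw [e]
      refine (abs_sub _ _).trans (add_le_add_right ?_ _)
      rw [abs_mul]
      refine mul_le_mul_of_nonneg_right ?_ (abs_nonneg _)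
      exact (abs_add_le _ _).trans ((add_le_add (abs_integral_le_of_bound hK _)
        (abs_integral_le_of_bound hK _)).trans_eq (two_mul K).symm)
    refine (norm_sub_le_norm_sub_add_norm_sub _ _ _).trans (add_le_add h1 (h2.trans ?_))
    exact add_le_add h4 h5
  have hbd1 := (hd1.abs.add hd2.abs).const_mul (√(N : ℝ))
  have hbd2 := hl2.abs.add (hl1.abs.const_mul (2 * K))
  -- The limiting Gaussian factor is deterministic and can be moved inside the expectation.
  have e1 : m.charError (n + 1) N φ ψ - m.charError n N (m.pull Level.f n φ)
        (m.pull Level.c n ψ) * Real.exp (-σ / 2) =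
      ∫ u, (∫ v, Complex.exp ((√(N : ℝ) * (mean f v - a) : ℝ) * Complex.I)
          ∂(Measure.pi fun _ : Fin N => m.particleLaw n u) -
        Complex.exp ((√(N : ℝ) * (mean g u - 0) : ℝ) * Complex.I) * Real.exp (-σ / 2)) ∂P := by
    rw [integral_sub hXin (hY.mul_const _), integral_mul_const, charError, charError,
      m.integral_particleMarg_succ N n hX, hg0]
  rw [e1]
  refine (norm_integral_le_of_norm_le (((BddMeas.const _).add (hbd1.add hbd2)).integrable P)
    (.of_forall hpt)).trans ?_
  rw [integral_add (integrable_const _) ((hbd1.add hbd2).integrable P),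
    integral_add (hbd1.integrable P) (hbd2.integrable P), integral_const_mul (√(N : ℝ)),
    integral_add (hd1.abs.integrable P) (hd2.abs.integrable P),
    integral_add (hl2.abs.integrable P) ((hl1.abs.const_mul _).integrable P),
    integral_const_mul (2 * K)]
  simp only [integral_const, probReal_univ, one_smul]
  have h1 := mul_le_mul_of_nonneg_left (add_le_add (hC₁ N hN) (hC₂ N hN)) hs0.le
  -- The `O(1/N)` linearization error survives the scaling by `√N`.
  have h2 : √(N : ℝ) * (C₁ / N + C₂ / N) = (C₁ + C₂) * (√(N : ℝ))⁻¹ := by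
    rw [← Real.sqrt_div_self]
    ring
  rw [h2] at h1
  rw [add_mul]
  linarith

theorem tendsto_charError
    (hinv : ∀ (s : Level) (n : ℕ), ContinuousOn (quantile (m.etaBar s n)) (Set.Ioo (0 : ℝ) 1))
    (hMc : ∀ n, 1 ≤ n → IsFeller (m.Mc n))
    (hM : ∀ (s : Level) (n : ℕ), 1 ≤ n → IsFeller (m.M s n)) (hG : ∀ n, Continuous (m.G n))
    (n : ℕ) : ∀ {φ ψ : ℝ → ℝ}, Continuous φ → Continuous ψ → (∃ K, ∀ x, |φ x| ≤ K) →
      (∃ K, ∀ x, |ψ x| ≤ K) → Tendsto (fun N => m.charError n N φ ψ) atTop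
        (𝓝 ((Real.exp (-(m.asympVar n φ ψ) / 2) : ℝ) : ℂ)) := by
  induction n with
  | zero =>
    exact fun hφ hψ hφb hψb => tendsto_charError_zero hpos (BddMeas.of_continuous hφ hφb)
      (BddMeas.of_continuous hψ hψb)
  | succ n ih =>
    intro φ ψ hφ hψ hφb hψb
    have hφ' : BddMeas φ := BddMeas.of_continuous hφ hφb
    have hψ' : BddMeas ψ := BddMeas.of_continuous hψ hψb
    -- Continuity of `G` and the Feller property of `M` keep the pulled back functions in the class
    -- of the induction hypothesis.
    have hpull : ∀ (s : Level) {χ : ℝ → ℝ}, Continuous χ → (∃ K, ∀ x, |χ x| ≤ K) →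
        Continuous (m.pull s n χ) := fun s χ hχ hχb => by
      obtain ⟨K, hK⟩ := ((BddMeas.of_continuous hχ hχb).sub
        (BddMeas.const (∫ z, χ z ∂m.eta s (n + 1)))).bounded
      exact ((hG n).mul (hM s (n + 1) n.succ_pos (BoundedContinuousFunction.ofNormedAddCommGroup
        (fun y => χ y - ∫ z, χ z ∂m.eta s (n + 1)) (hχ.sub continuous_const) K hK))).div_const _
    have h1 := tendsto_charError_succ_sub hpos hinv n (hMc _ n.succ_pos) hφ hψ hφb hψb
    have h2 := ih (hpull Level.f hφ hφb) (hpull Level.c hψ hψb)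
      (m.bddMeas_pull Level.f n hφ').bounded (m.bddMeas_pull Level.c n hψ').bounded
    have h3 := h1.add (h2.mul_const ((Real.exp (-(∫ z, (φ z.1 - ψ z.2) ^ 2 ∂m.etaW (n + 1) -
          (∫ z, (φ z.1 - ψ z.2) ∂m.etaW (n + 1)) ^ 2) / 2) : ℝ) : ℂ))
    simp only [sub_add_cancel, zero_add] at h3
    rw [← Complex.ofReal_mul, ← Real.exp_add, ← add_div, ← neg_add,
      ← asympVar_succ hpos n hφ' hψ'] at h3
    exact h3

end Positive

/-! ### Scaled errors -/

theorem integral_empirical {N : ℕ} (u : Fin N → ℝ × ℝ) {f : ℝ × ℝ → ℝ} (hf : BddMeas f) :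
    ∫ z, f z ∂empirical u = mean f u := by
  rw [empirical, integral_smul_measure, integral_finsetSum_measure fun i _ =>
    hf.integrable (Measure.dirac (u i)), mean]
  simp only [integral_dirac' _ _ hf.measurable.stronglyMeasurable]
  simp

theorem scaledError_eq (m : CoupledModel) (n N : ℕ) {φ ψ : ℝ → ℝ} (h : BddMeas φ)
    (h' : BddMeas ψ) (u : ℕ → Fin N → ℝ × ℝ) :
    m.scaledError n N φ ψ u =
      √(N : ℝ) * (mean (fun z => φ z.1 - ψ z.2) (u n) - ∫ z, (φ z.1 - ψ z.2) ∂m.etaW n) := by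
  rw [scaledError, integral_empirical _ (bddMeas_diff h h')]

theorem measurable_scaledError (m : CoupledModel) (n N : ℕ) {φ ψ : ℝ → ℝ} (h : BddMeas φ)
    (h' : BddMeas ψ) : Measurable (m.scaledError n N φ ψ) := by
  simp only [funext (m.scaledError_eq n N h h')]
  exact ((((bddMeas_diff h h').mean N).measurable.comp (measurable_pi_apply n)).sub
    measurable_const).const_mul _

theorem sum_mul_scaledError (m : CoupledModel) (n N : ℕ) {q : ℕ} {φ ψ : Fin q → ℝ → ℝ}
    (h : ∀ i, BddMeas (φ i)) (h' : ∀ i, BddMeas (ψ i)) (t : Fin q → ℝ)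
    (u : ℕ → Fin N → ℝ × ℝ) :
    ∑ i, t i * m.scaledError n N (φ i) (ψ i) u =
      m.scaledError n N (fun x => ∑ i, t i * φ i x) (fun x => ∑ i, t i * ψ i x) u := by
  have hd : (fun z : ℝ × ℝ => ∑ i, t i * φ i z.1 - ∑ i, t i * ψ i z.2) =
      fun z => ∑ i, t i * (φ i z.1 - ψ i z.2) := by
    funext z
    simp only [mul_sub, Finset.sum_sub_distrib]
  rw [m.scaledError_eq n N (BddMeas.sum _ fun i => (h i).const_mul _)
    (BddMeas.sum _ fun i => (h' i).const_mul _), hd,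
    integral_finsetSum _ fun i _ => ((bddMeas_diff (h i) (h' i)).const_mul _).integrable _]
  have hm : mean (fun z : ℝ × ℝ => ∑ i, t i * (φ i z.1 - ψ i z.2)) (u n) =
      ∑ i, t i * mean (fun z : ℝ × ℝ => φ i z.1 - ψ i z.2) (u n) := by
    simp only [mean]
    rw [Finset.sum_comm, Finset.mul_sum]
    refine Finset.sum_congr rfl fun i _ => ?_
    rw [← Finset.mul_sum]
    ring
  rw [hm, ← Finset.sum_sub_distrib, Finset.mul_sum]
  refine Finset.sum_congr rfl fun i _ => ?_
  rw [m.scaledError_eq n N (h i) (h' i), integral_const_mul]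
  ring

end CoupledModel

end MLPF

/-! ### The multivariate central limit theorem. -/

theorem corollary1 (m : MLPF.CoupledModel)
    -- the filters are well defined
    (hpos : ∀ (s : MLPF.Level) (n : ℕ), 0 < ∫ x, m.G n x ∂m.eta s n)
    -- their distribution functions and generalized inverses are continuous
    (hcdf : ∀ (s : MLPF.Level) (n : ℕ), Continuous (cdf (m.etaBar s n)))
    (hinv : ∀ (s : MLPF.Level) (n : ℕ),
      ContinuousOn (MLPF.quantile (m.etaBar s n)) (Set.Ioo (0 : ℝ) 1))
    -- Feller and continuity hypotheses
    (hMc : ∀ n, 1 ≤ n → MLPF.IsFeller (m.Mc n))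
    (hM : ∀ (s : MLPF.Level) (n : ℕ), 1 ≤ n → MLPF.IsFeller (m.M s n))
    (hG : ∀ n, Continuous (m.G n))
    (n q : ℕ) (φ ψ : Fin q → BoundedContinuousFunction ℝ ℝ) :
    (m.asympCov n (fun i => ⇑(φ i)) (fun i => ⇑(ψ i))).PosSemidef ∧
    TendstoInDistribution
      (fun (N : ℕ) (u : ℕ → Fin N → ℝ × ℝ) =>
        (WithLp.toLp 2 fun i => m.scaledError n N (φ i) (ψ i) u : EuclideanSpace ℝ (Fin q)))
      atTop
      (id : EuclideanSpace ℝ (Fin q) → EuclideanSpace ℝ (Fin q))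
      (fun N : ℕ => m.systemLaw N)
      (multivariateGaussian 0 (m.asympCov n (fun i => ⇑(φ i)) (fun i => ⇑(ψ i)))) := by
  have hb : ∀ χ : BoundedContinuousFunction ℝ ℝ, MLPF.BddMeas χ := fun χ =>
    MLPF.BddMeas.of_continuous χ.continuous ⟨‖χ‖, χ.norm_coe_le_norm⟩
  have hpsd := MLPF.CoupledModel.posSemidef_asympCov hpos n (fun i => hb (φ i)) fun i => hb (ψ i)
  have hmeas : ∀ N : ℕ, Measurable fun u : ℕ → Fin N → ℝ × ℝ =>
      (WithLp.toLp 2 fun i => m.scaledError n N (φ i) (ψ i) u : EuclideanSpace ℝ (Fin q)) :=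
    fun N => (WithLp.measurable_toLp 2 _).comp (measurable_pi_lambda _ fun i =>
      m.measurable_scaledError n N (hb (φ i)) (hb (ψ i)))
  refine ⟨hpsd, fun N => (hmeas N).aemeasurable, aemeasurable_id, ?_⟩
  -- Lévy's continuity theorem; at a fixed `t` the vector of errors collapses to the scalar error of
  -- the combined pair, as in the Cramér-Wold device.
  refine ProbabilityMeasure.tendsto_iff_tendsto_charFun.2 fun t => ?_
  have hφt : MLPF.BddMeas fun x => ∑ i, t i * φ i x :=
    MLPF.BddMeas.sum _ fun i => (hb (φ i)).const_mul _
  have hψt : MLPF.BddMeas fun x => ∑ i, t i * ψ i x :=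
    MLPF.BddMeas.sum _ fun i => (hb (ψ i)).const_mul _
  have hlim := MLPF.CoupledModel.tendsto_charError hpos hinv hMc hM hG n
    (φ := fun x => ∑ i, t i * φ i x) (ψ := fun x => ∑ i, t i * ψ i x)
    (by fun_prop) (by fun_prop) hφt.bounded hψt.bounded
  have hright : charFun ((multivariateGaussian 0
      (m.asympCov n (fun i => ⇑(φ i)) (fun i => ⇑(ψ i)))).map id) t =
      ((Real.exp (-(m.asympVar n (fun x => ∑ i, t i * φ i x)
        (fun x => ∑ i, t i * ψ i x)) / 2) : ℝ) : ℂ) := by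
    -- Positive semidefiniteness is needed here for `multivariateGaussian` to have the prescribed
    -- covariance.
    rw [Measure.map_id, charFun_multivariateGaussian hpsd,
      ← MLPF.CoupledModel.sum_asympCov_eq_asympVar hpos n (fun i => hb (φ i)) (fun i => hb (ψ i)) t]
    simp [dotProduct, Matrix.mulVec, neg_div]
  have hleft : ∀ N : ℕ, charFun ((m.systemLaw N).map fun u : ℕ → Fin N → ℝ × ℝ =>
      (WithLp.toLp 2 fun i => m.scaledError n N (φ i) (ψ i) u : EuclideanSpace ℝ (Fin q))) t =
      m.charError n N (fun x => ∑ i, t i * φ i x) (fun x => ∑ i, t i * ψ i x) := by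
    intro N
    have hmX : Measurable fun v : Fin N → ℝ × ℝ => √(N : ℝ) *
        (MLPF.mean (fun z : ℝ × ℝ => ∑ i, t i * φ i z.1 - ∑ i, t i * ψ i z.2) v -
          ∫ z, (∑ i, t i * φ i z.1 - ∑ i, t i * ψ i z.2) ∂m.etaW n) :=
      ((((MLPF.CoupledModel.bddMeas_diff hφt hψt).mean N).sub
        (MLPF.BddMeas.const _)).const_mul _).measurable
    rw [charFun_apply, integral_map (hmeas N).aemeasurable (by fun_prop),
      MLPF.CoupledModel.charError, ← m.map_systemLaw N n,
      integral_map (measurable_pi_apply n).aemeasurable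
        (MLPF.CoupledModel.integrable_exp_mul_I _ hmX).aestronglyMeasurable]
    refine integral_congr_ae (.of_forall fun u => ?_)
    simp only
    rw [← m.scaledError_eq n N hφt hψt,
      ← m.sum_mul_scaledError n N (fun i => hb (φ i)) (fun i => hb (ψ i)) t u]
    simp [PiLp.inner_apply]
  simp only [ProbabilityMeasure.coe_mk, hleft, hright]
  exact hlim
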